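/- Let $k \geq 1$ be an integer, let $N := \mathbb{C}^k$ with coordinates $\sigma_1, \dots, \sigma_k$, put $\sigma_0 := 1$ and $\partial_h := \partial/\partial\sigma_h$, and let $\mathcal{O}_N$ and $D_N$ be the sheaves on $N$ of holomorphic functions and of holomorphic differential operators. For $\mu, \lambda \in \mathbb{C}$ put $E := \sum_{h=1}^k \sigma_h\partial_h$, $U_0 := \sum_{h=1}^k h\,\sigma_h\partial_h$, and define the left ideals of $D_N$ $$\mathcal{A} := \sum_{i \in [1,k-1],\, j \in [2,k]} D_N(\partial_i\partial_j - \partial_{i+1}\partial_{j-1}), \qquad \mathcal{I}_\mu := \mathcal{A} + \sum_{m=2}^k D_N\big(\partial_1\partial_{m-1} + \partial_m(E+\mu)\big), \qquad \mathcal{J}_{\mu,\lambda} := \mathcal{I}_\mu + D_N(U_0 - \lambda),$$ and the $D_N$-modules $\mathcal{W} := D_N/\mathcal{A}$ and $\mathcal{N}_{\mu,\lambda} := D_N/\mathcal{J}_{\mu,\lambda}$. For $\alpha \in \mathbb{N}^k$ with $\sum_j \alpha_j = q$ and $\sum_j j\alpha_j = r$, the class of $\partial^\alpha$ in $\mathcal{W}$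 depends only on $(q,r)$ and is denoted $y_{q,r}$. Let $\mathcal{W}_q \subset \mathcal{W}$ be the sub-$\mathcal{O}_N$-module generated by the $y_{q,r}$, $r \in [q,kq]$, and let $\mathcal{N}_{\mu,\lambda}(q) \subset \mathcal{N}_{\mu,\lambda}$ be the sub-$\mathcal{O}_N$-module of classes of differential operators of order at most $q$. For integers $q \ge 2$ and $r \in [q, k(q-1)]$ put $$\theta_{q,r} := \sum_{h=0}^k \big(r - \lambda - (q+\mu-1)h\big)\,\sigma_h\, y_{q,r+h} \in \mathcal{W}_q .$$ Let $q \geq 1$ be an integer and assume that $\lambda$ is not an integer in $[0, k(q-1)]$. Then the $\mathcal{O}_N$-linear map $L_q : \mathcal{W}_q \to \mathcal{N}_{\mu,\lambda}(q)$ induced by the quotient map $\mathcal{W} \to \mathcal{N}_{\mu,\lambda}$ is a surjective morphism of sheaves, and its kernel is the free sub-$\mathcal{O}_N$-module of $\mathcal{W}_q$ with basis the $\theta_{q,r}$, $r \in [q, k(q-1)]$ (so $L_q$ is injective if this interval is empty, in particular if $q = 1$). Consequently $\mathcal{N}_{\mu,\lambda}(q)$ is a free $\mathcal{O}_N$-module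 of rank $k$. -/

import Mathlib

open Filter Topology TopologicalSpace

noncomputable section

namespace MuTrace

/-- The space `N = ℂ^k`, with coordinates `σ_1, …, σ_k`; the coordinate `σ_h` is `fun x => x i`
with `i : Fin k` and `h = i + 1`. -/
abbrev Pt (k : ℕ) : Type := Fin k → ℂ

/-! ### Germs of holomorphic functions and of holomorphic differential operators -/

/-- Germs of complex functions form a `ℂ`-algebra (for the pointwise operations). -/
instance instAlgebraGerm {k : ℕ} (x : Pt k) : Algebra ℂ (Germ (𝓝 x) ℂ) :=
  Algebra.ofModule
    (fun c f g => Germ.inductionOn₂ f g fun f g =>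
      congrArg (fun h : Pt k → ℂ => (h : Germ (𝓝 x) ℂ)) (smul_mul_assoc c f g))
    (fun c f g => Germ.inductionOn₂ f g fun f g =>
      congrArg (fun h : Pt k → ℂ => (h : Germ (𝓝 x) ℂ)) (mul_smul_comm c f g))

/-- The algebra of germs at `x` of holomorphic functions. -/
def holAlg {k : ℕ} (x : Pt k) : Subalgebra ℂ (Germ (𝓝 x) ℂ) where
  carrier := {g | ∃ f : Pt k → ℂ, AnalyticAt ℂ f x ∧ (f : Germ (𝓝 x) ℂ) = g}
  mul_mem' := by
    rintro _ _ ⟨f, hf, rfl⟩ ⟨g, hg, rfl⟩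
    exact ⟨f * g, hf.mul hg, rfl⟩
  add_mem' := by
    rintro _ _ ⟨f, hf, rfl⟩ ⟨g, hg, rfl⟩
    exact ⟨f + g, hf.add hg, rfl⟩
  algebraMap_mem' c := by
    refine ⟨c • (fun _ => (1 : ℂ)), (analyticAt_const : AnalyticAt ℂ (fun _ => (1 : ℂ)) x).const_smul, ?_⟩
    rw [Algebra.algebraMap_eq_smul_one]
    rfl

/-- The ring `O_{N,x}` of germs at `x` of holomorphic functions. -/
def HolGerm {k : ℕ} (x : Pt k) : Type := holAlg x

instance instCommRingHolGerm {k : ℕ} (x : Pt k) : CommRing (HolGerm x) :=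
  inferInstanceAs (CommRing (holAlg x))

instance instAlgebraHolGerm {k : ℕ} (x : Pt k) : Algebra ℂ (HolGerm x) :=
  inferInstanceAs (Algebra ℂ (holAlg x))

/-- The germ at `x` of a function that is holomorphic near `x`. -/
def germAt {k : ℕ} (x : Pt k) (f : Pt k → ℂ) (hf : AnalyticAt ℂ f x) : HolGerm x :=
  ⟨(f : Germ (𝓝 x) ℂ), f, hf, rfl⟩

/-- The partial derivative `∂f/∂σ` in the direction of the `i`-th coordinate. -/
def pderivFun {k : ℕ} (i : Fin k) (f : Pt k → ℂ) : Pt k → ℂ :=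
  fun y => fderiv ℂ f y (Pi.single i 1)

theorem pderivFun_analyticAt {k : ℕ} {x : Pt k} (i : Fin k) {f : Pt k → ℂ}
    (hf : AnalyticAt ℂ f x) : AnalyticAt ℂ (pderivFun i f) x :=
  ((ContinuousLinearMap.apply ℂ ℂ (Pi.single i 1 : Pt k)).analyticAt _).comp
    (AnalyticAt.fderiv hf)

theorem pderivFun_congr {k : ℕ} {x : Pt k} (i : Fin k) {f g : Pt k → ℂ} (h : f =ᶠ[𝓝 x] g) :
    pderivFun i f =ᶠ[𝓝 x] pderivFun i g := by
  filter_upwards [h.fderiv (𝕜 := ℂ)] with y hy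
  simp only [pderivFun, hy]

/-- The partial derivative on germs of arbitrary functions (meaningful on holomorphic ones). -/
def pderivGerm {k : ℕ} (x : Pt k) (i : Fin k) : Germ (𝓝 x) ℂ → Germ (𝓝 x) ℂ :=
  Quotient.map (pderivFun i) (fun _ _ h => pderivFun_congr i h)

theorem pderivGerm_coe {k : ℕ} (x : Pt k) (i : Fin k) (f : Pt k → ℂ) :
    pderivGerm x i (f : Germ (𝓝 x) ℂ) = (pderivFun i f : Germ (𝓝 x) ℂ) := rfl

/-- The partial derivative as a `ℂ`-linear endomorphism of `O_{N,x}`. -/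
def pderivEnd {k : ℕ} (x : Pt k) (i : Fin k) : Module.End ℂ (HolGerm x) where
  toFun g := ⟨pderivGerm x i g.1, by
    obtain ⟨_, f, hf, rfl⟩ := g
    exact ⟨pderivFun i f, pderivFun_analyticAt i hf, rfl⟩⟩
  map_add' := by
    rintro ⟨_, f, hf, rfl⟩ ⟨_, g, hg, rfl⟩
    apply Subtype.ext
    change ((pderivFun i (f + g) : Pt k → ℂ) : Germ (𝓝 x) ℂ) =
      ((pderivFun i f + pderivFun i g : Pt k → ℂ) : Germ (𝓝 x) ℂ)
    refine Germ.coe_eq.2 ?_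
    filter_upwards [hf.eventually_analyticAt, hg.eventually_analyticAt] with y h1 h2
    simp only [pderivFun, Pi.add_apply]
    rw [fderiv_add h1.differentiableAt h2.differentiableAt]
    rfl
  map_smul' := by
    rintro c ⟨_, f, hf, rfl⟩
    apply Subtype.ext
    change ((pderivFun i (c • f) : Pt k → ℂ) : Germ (𝓝 x) ℂ) =
      ((c • pderivFun i f : Pt k → ℂ) : Germ (𝓝 x) ℂ)
    refine Germ.coe_eq.2 ?_
    filter_upwards [hf.eventually_analyticAt] with y h1
    simp only [pderivFun, Pi.smul_apply]
    rw [fderiv_const_smul h1.differentiableAt]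
    rfl

/-- The ring `D_{N,x}` of germs at `x` of holomorphic differential operators: the algebra of
endomorphisms of `O_{N,x}` generated by the multiplications and the partial derivatives. -/
def diffOpAlg {k : ℕ} (x : Pt k) : Subalgebra ℂ (Module.End ℂ (HolGerm x)) :=
  Algebra.adjoin ℂ
    (Set.range (fun g : HolGerm x => LinearMap.mulLeft ℂ g) ∪ Set.range (pderivEnd x))

/-- `D_{N,x}` as a type. -/
def DOp {k : ℕ} (x : Pt k) : Type := diffOpAlg x

instance instRingDOp {k : ℕ} (x : Pt k) : Ring (DOp x) :=
  inferInstanceAs (Ring (diffOpAlg x))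

instance instAlgebraDOp {k : ℕ} (x : Pt k) : Algebra ℂ (DOp x) :=
  inferInstanceAs (Algebra ℂ (diffOpAlg x))

/-- The partial derivative `∂_{i+1}` as an element of `D_{N,x}`. -/
def pd {k : ℕ} (x : Pt k) (i : Fin k) : DOp x :=
  ⟨pderivEnd x i, Algebra.subset_adjoin (Or.inr ⟨i, rfl⟩)⟩

/-- The inclusion of `O_{N,x}` in `D_{N,x}` by multiplication operators. -/
def ofHol {k : ℕ} (x : Pt k) : HolGerm x →+* DOp x where
  toFun g := ⟨LinearMap.mulLeft ℂ g, Algebra.subset_adjoin (Or.inl ⟨g, rfl⟩)⟩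
  map_one' := Subtype.ext (LinearMap.ext fun h => one_mul h)
  map_mul' f g := Subtype.ext (LinearMap.ext fun h => mul_assoc f g h)
  map_zero' := Subtype.ext (LinearMap.ext fun h => zero_mul h)
  map_add' f g := Subtype.ext (LinearMap.ext fun h => add_mul f g h)

/-- `D_{N,x}` is an `O_{N,x}`-module by left multiplication. -/
instance instModuleDOp {k : ℕ} (x : Pt k) : Module (HolGerm x) (DOp x) :=
  Module.compHom (DOp x) (ofHol x)

instance instIsScalarTowerDOp {k : ℕ} (x : Pt k) :
    IsScalarTower (HolGerm x) (DOp x) (DOp x) :=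
  ⟨fun f P Q => mul_assoc (ofHol x f) P Q⟩

/-- The germ at `x` of the coordinate function `σ_{i+1}`. -/
def coord {k : ℕ} (x : Pt k) (i : Fin k) : HolGerm x :=
  germAt x (fun y => y i) ((ContinuousLinearMap.proj (R := ℂ) i).analyticAt x)

/-- The coordinate `σ_{i+1}` as an operator of order `0`. -/
def sg {k : ℕ} (x : Pt k) (i : Fin k) : DOp x := ofHol x (coord x i)

/-- `∂^α` for a multi-index `α`. -/
def pdPow {k : ℕ} (x : Pt k) (α : Fin k → ℕ) : DOp x :=
  (List.ofFn fun i => pd x i ^ α i).prod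

/-- The length `|α| = ∑_h α_h`. -/
def len {k : ℕ} (α : Fin k → ℕ) : ℕ := ∑ i, α i

/-- The weight `w(α) = ∑_h h α_h`. -/
def wt {k : ℕ} (α : Fin k → ℕ) : ℕ := ∑ i : Fin k, ((i : ℕ) + 1) * α i

/-- The vector field `E = ∑_h σ_h ∂_h`. -/
def opE {k : ℕ} (x : Pt k) : DOp x := ∑ i, sg x i * pd x i

/-- The vector field `U_0 = ∑_h h σ_h ∂_h`. -/
def opU0 {k : ℕ} (x : Pt k) : DOp x :=
  ∑ i : Fin k, (((i : ℕ) + 1 : ℕ) : DOp x) * (sg x i * pd x i)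

/-- The operator `A_{i+1, j+2} = ∂_{i+1} ∂_{j+2} - ∂_{i+2} ∂_{j+1}`, where `i+1 ∈ [1, k-1]` and
`j+2 ∈ [2, k]`. -/
def opA {k : ℕ} (x : Pt k) (i j : ℕ) (hi : i + 1 < k) (hj : j + 1 < k) : DOp x :=
  pd x ⟨i, by omega⟩ * pd x ⟨j + 1, hj⟩ - pd x ⟨i + 1, hi⟩ * pd x ⟨j, by omega⟩

/-- The operator `T_μ^{m+2} = ∂_1 ∂_{m+1} + ∂_{m+2} (E + μ)`, where `m+2 ∈ [2, k]`. -/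
def opT {k : ℕ} (x : Pt k) (μ : ℂ) (m : ℕ) (hm : m + 1 < k) : DOp x :=
  pd x ⟨0, by omega⟩ * pd x ⟨m, by omega⟩ +
    pd x ⟨m + 1, hm⟩ * (opE x + algebraMap ℂ (DOp x) μ)

/-! ### The left ideals and the quotient modules (stalks) -/

/-- The stalk at `x` of the left ideal `A`, generated by the `A_{i,j}`. -/
def idealA {k : ℕ} (x : Pt k) : Submodule (DOp x) (DOp x) :=
  Submodule.span (DOp x)
    {P | ∃ (i j : ℕ) (hi : i + 1 < k) (hj : j + 1 < k), P = opA x i j hi hj}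

/-- The stalk at `x` of the left ideal `I_μ = A + ∑_m D_N T_μ^m`. -/
def idealI {k : ℕ} (x : Pt k) (μ : ℂ) : Submodule (DOp x) (DOp x) :=
  idealA x ⊔ Submodule.span (DOp x) {P | ∃ (m : ℕ) (hm : m + 1 < k), P = opT x μ m hm}

/-- The stalk at `x` of the left ideal `J_{μ,λ} = I_μ + D_N (U_0 - λ)`. -/
def idealJ {k : ℕ} (x : Pt k) (μ lam : ℂ) : Submodule (DOp x) (DOp x) :=
  idealI x μ ⊔ Submodule.span (DOp x) {opU0 x - algebraMap ℂ (DOp x) lam}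

/-- The stalk at `x` of the `D_N`-module `W = D_N / A`. -/
abbrev WStalk {k : ℕ} (x : Pt k) : Type := DOp x ⧸ idealA x

/-- The stalk at `x` of the `D_N`-module `N_{μ,λ} = D_N / J_{μ,λ}`. -/
abbrev NStalk {k : ℕ} (μ lam : ℂ) (x : Pt k) : Type := DOp x ⧸ idealJ x μ lam

theorem idealA_le_idealJ {k : ℕ} (x : Pt k) (μ lam : ℂ) : idealA x ≤ idealJ x μ lam :=
  le_sup_left.trans le_sup_left

/-- The quotient map `W → N_{μ,λ}` on stalks. -/
def quotStalk {k : ℕ} (μ lam : ℂ) (x : Pt k) : WStalk x →ₗ[DOp x] NStalk μ lam x :=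
  Submodule.factor (idealA_le_idealJ x μ lam)

/-! ### Sheaves of `O_N`-modules

A section over `U` of a sheaf is given by the family of its germs at the points of `U`. -/

/-- The ring `O_N(U)` of holomorphic functions on `U`, each given by the family of its germs. -/
def HolSec {k : ℕ} (U : Opens (Pt k)) : Subring (∀ x : U, HolGerm (x : Pt k)) where
  carrier := {s | ∃ (f : Pt k → ℂ) (hf : ∀ x : U, AnalyticAt ℂ f x),
    ∀ x : U, s x = germAt (x : Pt k) f (hf x)}
  mul_mem' := by
    rintro s t ⟨f, hf, hs⟩ ⟨g, hg, ht⟩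
    exact ⟨f * g, fun x => (hf x).mul (hg x), fun x => by
      rw [Pi.mul_apply, hs x, ht x]; rfl⟩
  add_mem' := by
    rintro s t ⟨f, hf, hs⟩ ⟨g, hg, ht⟩
    exact ⟨f + g, fun x => (hf x).add (hg x), fun x => by
      rw [Pi.add_apply, hs x, ht x]; rfl⟩
  one_mem' := ⟨fun _ => 1, fun _ => analyticAt_const, fun _ => rfl⟩
  zero_mem' := ⟨fun _ => 0, fun _ => analyticAt_const, fun _ => rfl⟩
  neg_mem' := by
    rintro s ⟨f, hf, hs⟩
    exact ⟨-f, fun x => (hf x).neg, fun x => by rw [Pi.neg_apply, hs x]; rfl⟩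

section Sheaf

variable {k : ℕ}

/-- Families of germs over `U`. -/
def Fam (F : Pt k → Type) (U : Opens (Pt k)) : Type := ∀ x : U, F (x : Pt k)

variable {F : Pt k → Type}

/-- Restriction of families of germs. -/
def res {U V : Opens (Pt k)} (h : V ≤ U) (s : Fam F U) : Fam F V :=
  fun x => s ⟨x, h x.2⟩

/-- The family of germs over `U` given by a global family. -/
def glob (U : Opens (Pt k)) (g : ∀ x : Pt k, F x) : Fam F U := fun x => g x

variable [∀ x, AddCommGroup (F x)] [∀ x, Module (HolGerm x) (F x)]

instance instAddCommGroupFam (U : Opens (Pt k)) : AddCommGroup (Fam F U) :=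
  inferInstanceAs (AddCommGroup (∀ x : U, F (x : Pt k)))

/-- Multiplication of a family of germs by a holomorphic function is done pointwise. -/
instance instModuleFam (U : Opens (Pt k)) : Module (HolSec U) (Fam F U) where
  smul f s := fun x => f.1 x • s x
  one_smul s := funext fun x => one_smul _ (s x)
  mul_smul f g s := funext fun x => mul_smul (f.1 x) (g.1 x) (s x)
  smul_zero f := funext fun x => smul_zero (f.1 x)
  smul_add f s t := funext fun x => smul_add (f.1 x) (s x) (t x)
  add_smul f g s := funext fun x => add_smul (f.1 x) (g.1 x) (s x)
  zero_smul s := funext fun x => zero_smul _ (s x)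

/-- Restriction of holomorphic functions. -/
def resHol {U V : Opens (Pt k)} (h : V ≤ U) (f : HolSec U) : HolSec V :=
  ⟨fun x => f.1 ⟨x, h x.2⟩, by
    obtain ⟨g, hg, hs⟩ := f.2
    exact ⟨g, fun x => hg ⟨x, h x.2⟩, fun x => hs ⟨x, h x.2⟩⟩⟩

/-- The presheaf `O_N`-linear combinations over `V` of a set `G` of global sections. -/
def combSec (G : Set (∀ x : Pt k, F x)) (V : Opens (Pt k)) :
    Submodule (HolSec V) (Fam F V) :=
  Submodule.span (HolSec V) {s | ∃ g ∈ G, s = glob V g}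

theorem res_mem_combSec (G : Set (∀ x : Pt k, F x)) {U V : Opens (Pt k)} (h : V ≤ U)
    {s : Fam F U} (hs : s ∈ combSec G U) : res h s ∈ combSec G V := by
  induction hs using Submodule.span_induction with
  | mem s hs =>
    obtain ⟨g, hg, rfl⟩ := hs
    exact Submodule.subset_span ⟨g, hg, rfl⟩
  | zero => exact (combSec G V).zero_mem
  | add s t _ _ hs ht => exact (combSec G V).add_mem hs ht
  | smul f s _ hs => exact (combSec G V).smul_mem (resHol h f) hs

/-- The sections over `U` of the sheaf of `O_N`-modules generated by a set `G` of global
sections: the families of germs which locally are `O_N`-linear combinations of elements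
of `G`. -/
def genSheaf (G : Set (∀ x : Pt k, F x)) (U : Opens (Pt k)) :
    Submodule (HolSec U) (Fam F U) where
  carrier := {s | ∀ x : U, ∃ (V : Opens (Pt k)) (h : V ≤ U), (x : Pt k) ∈ V ∧
    res h s ∈ combSec G V}
  add_mem' := by
    intro s t hs ht x
    obtain ⟨V, hV, hxV, hsV⟩ := hs x
    obtain ⟨V', hV', hxV', htV'⟩ := ht x
    refine ⟨V ⊓ V', inf_le_left.trans hV, ⟨hxV, hxV'⟩, ?_⟩
    exact (combSec G (V ⊓ V')).add_mem
      (res_mem_combSec G (inf_le_left : V ⊓ V' ≤ V) hsV)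
      (res_mem_combSec G (inf_le_right : V ⊓ V' ≤ V') htV')
  zero_mem' := fun x => ⟨U, le_rfl, x.2, (combSec G U).zero_mem⟩
  smul_mem' := by
    intro f s hs x
    obtain ⟨V, hV, hxV, hsV⟩ := hs x
    exact ⟨V, hV, hxV, (combSec G V).smul_mem (resHol hV f) hsV⟩

/-- The sheaf generated by `G` is a free sheaf of `O_N`-modules of rank `n`: there are `n` global
sections whose restrictions to each open set `U` form a basis of the `O_N(U)`-module of sections
over `U`. -/
def IsFreeOfRank (G : Set (∀ x : Pt k, F x)) (n : ℕ) : Prop :=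
  ∃ e : Fin n → genSheaf G ⊤, ∀ U : Opens (Pt k),
    ∃ b : Module.Basis (Fin n) (HolSec U) (genSheaf G U),
      ∀ i, (b i : Fam F U) = res le_top (e i).1

end Sheaf

/-! ### The sheaves `W_q` and `N_{μ,λ}(q)` and the map `L_q` -/

/-- The classes in `W` of the `∂^α` with `|α| = q`. -/
def genW (k q : ℕ) : Set (∀ x : Pt k, WStalk x) :=
  {s | ∃ α : Fin k → ℕ, len α = q ∧ s = fun x => (idealA x).mkQ (pdPow x α)}

/-- The classes in `N_{μ,λ}` of the `∂^α` with `|α| ≤ q`. -/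
def genN (k : ℕ) (μ lam : ℂ) (q : ℕ) : Set (∀ x : Pt k, NStalk μ lam x) :=
  {s | ∃ α : Fin k → ℕ, len α ≤ q ∧ s = fun x => (idealJ x μ lam).mkQ (pdPow x α)}

/-- The sheaf `W_q`: the sub-`O_N`-module of `W` generated by the classes of the `∂^α` with
`|α| = q`. -/
def WSheaf (k q : ℕ) (U : Opens (Pt k)) :
    Submodule (HolSec U) (Fam WStalk U) :=
  genSheaf (genW k q) U

/-- The sheaf `N_{μ,λ}(q)`: the sub-`O_N`-module of `N_{μ,λ}` of the classes of operators of order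
at most `q`, i.e. of `O_N`-linear combinations of the `∂^α` with `|α| ≤ q`. -/
def NSheaf (k : ℕ) (μ lam : ℂ) (q : ℕ) (U : Opens (Pt k)) :
    Submodule (HolSec U) (Fam (NStalk μ lam) U) :=
  genSheaf (genN k μ lam q) U

theorem quotStalk_smul {k : ℕ} (μ lam : ℂ) (x : Pt k) (f : HolGerm x) (w : WStalk x) :
    quotStalk μ lam x (f • w) = f • quotStalk μ lam x w := by
  obtain ⟨P, rfl⟩ := (idealA x).mkQ_surjective w
  rfl

/-- The quotient map `W → N_{μ,λ}` on families of germs. -/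
def quotFam {k : ℕ} (μ lam : ℂ) (U : Opens (Pt k)) (s : Fam WStalk U) : Fam (NStalk μ lam) U :=
  fun x => quotStalk μ lam (x : Pt k) (s x)

/-- The quotient map `W → N_{μ,λ}` on families of germs, as a linear map. -/
def quotSec {k : ℕ} (μ lam : ℂ) (U : Opens (Pt k)) :
    Fam WStalk U →ₗ[HolSec U] Fam (NStalk μ lam) U where
  toFun := quotFam μ lam U
  map_add' s t := funext fun x => map_add (quotStalk μ lam (x : Pt k)) (s x) (t x)
  map_smul' f s := funext fun x => quotStalk_smul μ lam (x : Pt k) (f.1 x) (s x)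

theorem quotSec_mem {k : ℕ} (μ lam : ℂ) (q : ℕ) (U : Opens (Pt k))
    (s : Fam WStalk U) (hs : s ∈ WSheaf k q U) :
    quotSec μ lam U s ∈ NSheaf k μ lam q U := by
  intro x
  obtain ⟨V, hV, hxV, hsV⟩ := hs x
  refine ⟨V, hV, hxV, ?_⟩
  change quotSec μ lam V (res hV s) ∈ combSec (genN k μ lam q) V
  have key : combSec (genW k q) V ≤
      (combSec (genN k μ lam q) V).comap (quotSec μ lam V) := by
    refine Submodule.span_le.2 ?_
    rintro _ ⟨_, ⟨α, hα, rfl⟩, rfl⟩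
    exact Submodule.subset_span ⟨_, ⟨α, hα.le, rfl⟩, rfl⟩
  exact key hsV

/-- The `O_N`-linear map `L_q : W_q → N_{μ,λ}(q)` on sections over `U`. -/
def mapL (k : ℕ) (μ lam : ℂ) (q : ℕ) (U : Opens (Pt k)) :
    WSheaf k q U →ₗ[HolSec U] NSheaf k μ lam q U :=
  (quotSec μ lam U).restrict (quotSec_mem μ lam q U)

open Classical in
/-- The global section `y_{q,r}` of `W_q`: the class of `∂^α` for any `α` with `|α| = q` and
`w(α) = r` (the class does not depend on `α`, and there is such an `α` if `q ≤ r ≤ kq`). -/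
def yClass {k : ℕ} (x : Pt k) (q r : ℕ) : WStalk x :=
  if h : ∃ α : Fin k → ℕ, len α = q ∧ wt α = r then (idealA x).mkQ (pdPow x h.choose) else 0

/-- The germ at `x` of
`θ_{q,r} = ∑_{h=0}^k (r - λ - (q + μ - 1) h) σ_h y_{q,r+h}`, where `σ_0 = 1`. -/
def thetaStalk {k : ℕ} (μ lam : ℂ) (q r : ℕ) (x : Pt k) : WStalk x :=
  algebraMap ℂ (HolGerm x) (r - lam) • yClass x q r +
    ∑ h : Fin k, (algebraMap ℂ (HolGerm x) (r - lam - (q + μ - 1) * ((h : ℕ) + 1)) * coord x h) •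
      yClass x q (r + ((h : ℕ) + 1))

end MuTrace

end

noncomputable section

namespace MuTrace

/-! ### The ring of germs of holomorphic functions -/

/-! Write R = 1 + ∑ σ_h t^h, R' = t dR/dt and D = t d/dt − λ. The stalk of W is free over O on the
y_{q,r} with q ≤ r ≤ kq (`yClass_linearIndependent`, `span_yClass`), so its component of degree q is
the module of polynomials with exponents in [q, kq], t^r standing for y_{q,r}. Each ∂_i carries
relations of W → N to relations, shifting (q, r) to (q+1, r+i); hence the kernel is spanned over O
alone (`quotStalk_eq_zero_iff`) by the T-relations, aR in degree q+1 plus (q+μ)a in degree q, and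
the U-relations, bR' in degree q+1 plus Db in degree q.

A combination of relations of high degree could fall into low degree. Its top component cancels
exactly when aR + bR' = 0. The discriminant of R is a nonzero germ and R has constant term 1, so a =
cR' and b = −cR (`sigPoly_syzygy`). What remains is −θ(c), where θ(c) = Dc·R − (q+μ)cR' is itself a
combination of relations one degree lower (`mem_relLe_of_yCoeff_eq_zero`). So relations supported in
degrees ≤ n+1 come from generators in those degrees.

Put q = n+1 in the statement. The hypothesis on λ makes D invertible on exponents ≤ kn. Dividing by
D trades T-relations for θ's and, modulo U-relations, pushes every θ up to degree n+1
(`relLe_le_sup`). A sum of U-relations without components in degrees ≤ n is zero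
(`eq_zero_of_mem_relULe`), so a relation in W_{n+1} is some θ(c) (`exists_eq_relTheta`).

Finally θ_{n+1,r} equals (r−λ)y_{n+1,r} plus terms with larger r. By triangularity the θ_{n+1,r} and
the k classes y_{n+1,r} with r > kn form a basis of W_{n+1}, and the images of those k classes form
a basis of N(n+1). Coefficients in these bases are unique, so local ones glue
(`exists_basis_genSheaf`). -/

theorem exists_germAt {k : ℕ} {x : Pt k} (g : HolGerm x) :
    ∃ (f : Pt k → ℂ) (hf : AnalyticAt ℂ f x), g = germAt x f hf := by
  obtain ⟨_, f, hf, rfl⟩ := g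
  exact ⟨f, hf, rfl⟩

theorem germAt_eq_iff {k : ℕ} {x : Pt k} {f g : Pt k → ℂ} (hf : AnalyticAt ℂ f x)
    (hg : AnalyticAt ℂ g x) : germAt x f hf = germAt x g hg ↔ f =ᶠ[𝓝 x] g :=
  Subtype.ext_iff.trans Germ.coe_eq

theorem germAt_mul {k : ℕ} {x : Pt k} {f g : Pt k → ℂ} (hf : AnalyticAt ℂ f x)
    (hg : AnalyticAt ℂ g x) : germAt x f hf * germAt x g hg = germAt x (f * g) (hf.mul hg) :=
  rfl

theorem germAt_add {k : ℕ} {x : Pt k} {f g : Pt k → ℂ} (hf : AnalyticAt ℂ f x)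
    (hg : AnalyticAt ℂ g x) : germAt x f hf + germAt x g hg = germAt x (f + g) (hf.add hg) :=
  rfl

theorem germAt_zero {k : ℕ} (x : Pt k) : germAt x 0 analyticAt_const = 0 := rfl

theorem germAt_one {k : ℕ} (x : Pt k) : germAt x 1 analyticAt_const = 1 := rfl

theorem algebraMap_eq_germAt {k : ℕ} (x : Pt k) (c : ℂ) :
    algebraMap ℂ (HolGerm x) c = germAt x (fun _ => c) analyticAt_const := by
  rw [Algebra.algebraMap_eq_smul_one]
  apply Subtype.ext
  change ((c • (1 : Pt k → ℂ) : Pt k → ℂ) : Germ (𝓝 x) ℂ) = ((fun _ => c : Pt k → ℂ) : Germ (𝓝 x) ℂ)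
  congr 1
  funext y
  simp

instance instNontrivialHolGerm {k : ℕ} (x : Pt k) : Nontrivial (HolGerm x) := by
  refine ⟨0, 1, fun h => ?_⟩
  rw [← germAt_zero, ← germAt_one, germAt_eq_iff] at h
  exact zero_ne_one h.self_of_nhds

/-- Identity theorem: on a ball where fg = 0, if f is nonzero at one point then g vanishes near that
point, hence on the whole ball. -/
instance instIsDomainHolGerm {k : ℕ} (x : Pt k) : IsDomain (HolGerm x) := by
  have : NoZeroDivisors (HolGerm x) := by
    refine ⟨fun {a b} hab => ?_⟩
    obtain ⟨f, hf, rfl⟩ := exists_germAt a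
    obtain ⟨g, hg, rfl⟩ := exists_germAt b
    rw [germAt_mul, ← germAt_zero, germAt_eq_iff] at hab
    rw [← germAt_zero, germAt_eq_iff, germAt_eq_iff]
    obtain ⟨r, hr, hB⟩ := Metric.eventually_nhds_iff_ball.1
      (hab.and (hf.eventually_analyticAt.and hg.eventually_analyticAt))
    by_cases h : ∀ y ∈ Metric.ball x r, f y = 0
    · left
      filter_upwards [Metric.ball_mem_nhds x hr] with y hy using h y hy
    · right
      push Not at h
      obtain ⟨y, hy, hfy⟩ := h
      have hg0 : g =ᶠ[𝓝 y] 0 := by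
        filter_upwards [(hB y hy).2.1.continuousAt.eventually_ne hfy,
          Metric.isOpen_ball.mem_nhds hy] with z hz hz'
        exact (mul_eq_zero.1 (hB z hz').1).resolve_left hz
      have hgan : AnalyticOnNhd ℂ g (Metric.ball x r) := fun z hz => (hB z hz).2.2
      have := hgan.eqOn_zero_of_preconnected_of_eventuallyEq_zero
        (convex_ball x r).isPreconnected hy hg0
      filter_upwards [Metric.ball_mem_nhds x hr] with z hz using this hz
  exact NoZeroDivisors.to_isDomain _

theorem pderivEnd_germAt {k : ℕ} {x : Pt k} (i : Fin k) {f : Pt k → ℂ} (hf : AnalyticAt ℂ f x) :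
    pderivEnd x i (germAt x f hf) = germAt x (pderivFun i f) (pderivFun_analyticAt i hf) := rfl

theorem pderivEnd_mul {k : ℕ} {x : Pt k} (i : Fin k) (a b : HolGerm x) :
    pderivEnd x i (a * b) = a * pderivEnd x i b + pderivEnd x i a * b := by
  obtain ⟨f, hf, rfl⟩ := exists_germAt a
  obtain ⟨g, hg, rfl⟩ := exists_germAt b
  simp only [germAt_mul, pderivEnd_germAt, germAt_add]
  rw [germAt_eq_iff]
  filter_upwards [hf.eventually_analyticAt, hg.eventually_analyticAt] with y h1 h2
  simp only [pderivFun, Pi.add_apply, Pi.mul_apply]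
  rw [fderiv_mul h1.differentiableAt h2.differentiableAt]
  simp [mul_comm]

theorem coord_analyticAt {k : ℕ} (x : Pt k) (j : Fin k) : AnalyticAt ℂ (fun y : Pt k => y j) x :=
  (ContinuousLinearMap.proj (R := ℂ) (φ := fun _ : Fin k => ℂ) j).analyticAt x

theorem coord_eq_germAt {k : ℕ} (x : Pt k) (j : Fin k) :
    coord x j = germAt x (fun y => y j) (coord_analyticAt x j) := rfl

theorem pderivEnd_coord {k : ℕ} {x : Pt k} (i j : Fin k) :
    pderivEnd x i (coord x j) = if i = j then 1 else 0 := by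
  rw [coord_eq_germAt, pderivEnd_germAt]
  have : pderivFun i (fun y : Pt k => y j) = fun _ => if i = j then 1 else 0 := by
    funext y
    have : fderiv ℂ (fun y : Pt k => y j) y = ContinuousLinearMap.proj (R := ℂ) j :=
      (ContinuousLinearMap.proj (R := ℂ) (φ := fun _ : Fin k => ℂ) j).fderiv
    simp [pderivFun, this, Pi.single_apply, eq_comm]
  simp only [this]
  split_ifs <;> rfl

theorem pderivEnd_algebraMap {k : ℕ} {x : Pt k} (i : Fin k) (c : ℂ) :
    pderivEnd x i (algebraMap ℂ (HolGerm x) c) = 0 := by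
  rw [algebraMap_eq_germAt, pderivEnd_germAt]
  have : pderivFun i (fun _ : Pt k => c) = 0 := by
    funext y
    simp [pderivFun]
  simp only [this]
  rfl

theorem pderivFun_comm {k : ℕ} {x : Pt k} (i j : Fin k) {f : Pt k → ℂ} (hf : AnalyticAt ℂ f x) :
    pderivFun i (pderivFun j f) x = pderivFun j (pderivFun i f) x := by
  have hs : IsSymmSndFDerivAt ℂ f x := (hf.contDiffAt (n := ⊤)).isSymmSndFDerivAt_of_omega
  have hd : DifferentiableAt ℂ (fderiv ℂ f) x := hf.fderiv.differentiableAt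
  have key : ∀ a b : Fin k, pderivFun a (pderivFun b f) x =
      fderiv ℂ (fderiv ℂ f) x (Pi.single a 1) (Pi.single b 1) := by
    intro a b
    unfold pderivFun
    rw [fderiv_clm_apply hd (differentiableAt_const _)]
    simp
  rw [key, key]
  exact hs _ _

theorem pderivEnd_comm {k : ℕ} {x : Pt k} (i j : Fin k) :
    pderivEnd x i * pderivEnd x j = pderivEnd x j * pderivEnd x i := by
  refine LinearMap.ext fun a => ?_
  obtain ⟨f, hf, rfl⟩ := exists_germAt a
  simp only [Module.End.mul_apply, pderivEnd_germAt]
  rw [germAt_eq_iff]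
  filter_upwards [hf.eventually_analyticAt] with y h1
  exact pderivFun_comm i j h1

/-- The germ of `exp (u ∑_h σ_h t^h)`. -/
def expGerm {k : ℕ} (x : Pt k) (u t : ℂ) : HolGerm x :=
  germAt x (fun y => Complex.exp (∑ h : Fin k, u * t ^ ((h : ℕ) + 1) * y h)) (by
    refine AnalyticAt.cexp' ?_
    refine Finset.analyticAt_fun_sum _ fun h _ => analyticAt_const.mul ?_
    exact (ContinuousLinearMap.proj (R := ℂ) h).analyticAt x)

theorem expGerm_ne_zero {k : ℕ} (x : Pt k) (u t : ℂ) : expGerm x u t ≠ 0 := by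
  intro h
  rw [expGerm, ← germAt_zero, germAt_eq_iff] at h
  exact Complex.exp_ne_zero _ h.self_of_nhds

theorem pderivEnd_expGerm {k : ℕ} (x : Pt k) (u t : ℂ) (i : Fin k) :
    pderivEnd x i (expGerm x u t) = (u * t ^ ((i : ℕ) + 1)) • expGerm x u t := by
  rw [Algebra.smul_def, algebraMap_eq_germAt]
  rw [expGerm, pderivEnd_germAt, germAt_mul, germAt_eq_iff]
  refine Eventually.of_forall fun y => ?_
  have h1 : HasFDerivAt (fun y : Pt k => ∑ h : Fin k, u * t ^ ((h : ℕ) + 1) * y h)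
      (∑ h : Fin k, (u * t ^ ((h : ℕ) + 1)) •
        (ContinuousLinearMap.proj (R := ℂ) h : Pt k →L[ℂ] ℂ)) y :=
    HasFDerivAt.fun_sum fun h _ =>
      (ContinuousLinearMap.proj (R := ℂ) (φ := fun _ : Fin k => ℂ) h).hasFDerivAt.const_mul _
  simp only [pderivFun, h1.cexp.fderiv, Pi.mul_apply]
  simp [Pi.single_apply, mul_comm]

/-- A polynomial in the coordinates that vanishes near a point is zero. -/
theorem aeval_coord_injective {k : ℕ} (x : Pt k) :
    Function.Injective (MvPolynomial.aeval (coord x) : MvPolynomial (Fin k) ℂ →ₐ[ℂ] HolGerm x) := by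
  have hval : ∀ p : MvPolynomial (Fin k) ℂ, ∃ hp : AnalyticAt ℂ (fun y => MvPolynomial.eval y p) x,
      MvPolynomial.aeval (coord x) p = germAt x (fun y => MvPolynomial.eval y p) hp := by
    intro p
    induction p using MvPolynomial.induction_on with
    | C a =>
      refine ⟨by simpa using analyticAt_const, ?_⟩
      rw [MvPolynomial.aeval_C, algebraMap_eq_germAt]
      simp
    | add p q hp hq =>
      obtain ⟨hp, ep⟩ := hp
      obtain ⟨hq, eq⟩ := hq
      refine ⟨by simpa using hp.fun_add hq, ?_⟩
      rw [map_add, ep, eq, germAt_add, germAt_eq_iff]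
      exact Eventually.of_forall fun y => by simp
    | mul_X p i hp =>
      obtain ⟨hp, ep⟩ := hp
      refine ⟨by simpa using hp.fun_mul (coord_analyticAt x i), ?_⟩
      rw [map_mul, ep, MvPolynomial.aeval_X, coord_eq_germAt, germAt_mul, germAt_eq_iff]
      exact Eventually.of_forall fun y => by simp
  rw [injective_iff_map_eq_zero]
  intro p hp
  obtain ⟨h, e⟩ := hval p
  rw [e, ← germAt_zero, germAt_eq_iff] at hp
  obtain ⟨r, hr, hB⟩ := Metric.eventually_nhds_iff_ball.1 hp
  -- A ball for the sup norm is a product of discs, which are infinite sets.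
  refine MvPolynomial.funext_set (fun i => Metric.ball (x i) r) (fun i => ?_) fun y hy => ?_
  · exact Set.Infinite.mono Set.Subset.rfl
      (infinite_of_mem_nhds (x i) (Metric.ball_mem_nhds (x i) hr))
  · rw [map_zero]
    refine hB y ?_
    rw [← ball_pi _ hr] at *
    exact hy

/-! ### The ring of germs of differential operators -/

/-- The action of differential operators on holomorphic germs. -/
def toEnd {k : ℕ} (x : Pt k) : DOp x →ₐ[ℂ] Module.End ℂ (HolGerm x) := (diffOpAlg x).val

/-- The operator given by an endomorphism in the algebra of differential operators. -/
def dopMk {k : ℕ} (x : Pt k) (P : Module.End ℂ (HolGerm x)) (hP : P ∈ diffOpAlg x) : DOp x :=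
  ⟨P, hP⟩

theorem toEnd_injective {k : ℕ} (x : Pt k) : Function.Injective (toEnd x) :=
  Subtype.val_injective

theorem toEnd_pd {k : ℕ} (x : Pt k) (i : Fin k) : toEnd x (pd x i) = pderivEnd x i := rfl

theorem toEnd_ofHol {k : ℕ} (x : Pt k) (f g : HolGerm x) : toEnd x (ofHol x f) g = f * g := rfl

theorem hol_smul_def {k : ℕ} {x : Pt k} (f : HolGerm x) (P : DOp x) : f • P = ofHol x f * P := rfl

theorem ofHol_algebraMap {k : ℕ} (x : Pt k) (c : ℂ) :
    ofHol x (algebraMap ℂ (HolGerm x) c) = algebraMap ℂ (DOp x) c := by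
  apply toEnd_injective
  refine LinearMap.ext fun g => ?_
  rw [toEnd_ofHol, AlgHom.commutes, Module.algebraMap_end_apply, Algebra.smul_def]

theorem pd_comm {k : ℕ} (x : Pt k) (i j : Fin k) : pd x i * pd x j = pd x j * pd x i :=
  toEnd_injective x (by simpa only [map_mul, toEnd_pd] using pderivEnd_comm i j)

theorem pd_mul_ofHol {k : ℕ} (x : Pt k) (i : Fin k) (f : HolGerm x) :
    pd x i * ofHol x f = ofHol x f * pd x i + ofHol x (pderivEnd x i f) := by
  apply toEnd_injective
  refine LinearMap.ext fun g => ?_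
  simp only [map_mul, map_add, LinearMap.add_apply, Module.End.mul_apply, toEnd_ofHol, toEnd_pd,
    pderivEnd_mul]

/-! ### Modules over the ring of operators -/

section DModule

variable {k : ℕ} {x : Pt k} {M : Type*} [AddCommGroup M] [Module (DOp x) M] [Module (HolGerm x) M]
  [IsScalarTower (HolGerm x) (DOp x) M]

theorem ofHol_smul (f : HolGerm x) (m : M) : ofHol x f • m = f • m := by
  have : f • (1 : DOp x) = ofHol x f := by rw [hol_smul_def, mul_one]
  rw [← this, smul_assoc, one_smul]

theorem pd_smul_hol_smul (i : Fin k) (f : HolGerm x) (m : M) :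
    pd x i • f • m = f • pd x i • m + pderivEnd x i f • m := by
  rw [← ofHol_smul f m, ← mul_smul, pd_mul_ofHol, add_smul, mul_smul, ofHol_smul, ofHol_smul]

/-- Multiplications and derivatives generate all operators. This is what allows an O-span to be
compared with a left ideal. -/
theorem dop_smul_mem (N : Submodule (HolGerm x) M) (h : ∀ i, ∀ m ∈ N, pd x i • m ∈ N)
    (P : DOp x) : ∀ m ∈ N, P • m ∈ N := by
  obtain ⟨P, hP⟩ := P
  have key : ∀ (P : Module.End ℂ (HolGerm x)) (hP : P ∈ diffOpAlg x), ∀ m ∈ N,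
      dopMk x P hP • m ∈ N := by
    intro P hP
    refine Algebra.adjoin_induction (p := fun P hP => ∀ m ∈ N, dopMk x P hP • m ∈ N)
      ?_ ?_ ?_ ?_ hP
    · rintro _ (⟨g, rfl⟩ | ⟨i, rfl⟩) m hm
      · exact (ofHol_smul g m).symm ▸ N.smul_mem g hm
      · exact h i m hm
    · intro c m hm
      have := N.smul_mem (algebraMap ℂ (HolGerm x) c) hm
      rwa [← ofHol_smul, ofHol_algebraMap] at this
    · intro P Q hP hQ h1 h2 m hm
      exact (add_smul (dopMk x P hP) (dopMk x Q hQ) m).symm ▸ N.add_mem (h1 m hm) (h2 m hm)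
    · intro P Q hP hQ h1 h2 m hm
      exact (mul_smul (dopMk x P hP) (dopMk x Q hQ) m).symm ▸ h1 _ (h2 m hm)
  exact key P hP

/-- By the Leibniz rule, stability under ∂_i need only be checked on O-generators. -/
theorem pd_smul_mem_span {s : Set M}
    (h : ∀ i, ∀ m ∈ s, pd x i • m ∈ Submodule.span (HolGerm x) s) (i : Fin k) :
    ∀ m ∈ Submodule.span (HolGerm x) s, pd x i • m ∈ Submodule.span (HolGerm x) s := by
  intro m hm
  induction hm using Submodule.span_induction with
  | mem m hm => exact h i m hm
  | zero => rw [smul_zero]; exact Submodule.zero_mem _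
  | add a b _ _ ha hb => rw [smul_add]; exact Submodule.add_mem _ ha hb
  | smul f m hm ih =>
    rw [pd_smul_hol_smul]
    exact Submodule.add_mem _ (Submodule.smul_mem _ _ ih) (Submodule.smul_mem _ _ hm)

end DModule

/-! ### Monomials in the partial derivatives -/

theorem adjoin_pd_comm {k : ℕ} (x : Pt k) :
    ∀ a ∈ Set.range (pd x), ∀ b ∈ Set.range (pd x), a * b = b * a := by
  rintro _ ⟨i, rfl⟩ _ ⟨j, rfl⟩
  exact pd_comm x i j

-- The ordered product defining `pdPow` is computed in the commutative algebra generated by the ∂_i.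
open scoped IsMulCommutative in
theorem pdPow_add_single {k : ℕ} (x : Pt k) (α : Fin k → ℕ) (i : Fin k) :
    pdPow x (α + Pi.single i 1) = pd x i * pdPow x α := by
  let C := Algebra.adjoin ℂ (Set.range (pd x))
  have : IsMulCommutative C := Algebra.isMulCommutative_adjoin ℂ (adjoin_pd_comm x)
  let d : Fin k → C := fun i => ⟨pd x i, Algebra.subset_adjoin ⟨i, rfl⟩⟩
  have h : ∀ β : Fin k → ℕ, pdPow x β = ((∏ j, d j ^ β j : C) : DOp x) := by
    intro β
    rw [← List.prod_ofFn]
    change _ = C.val.toRingHom.toMonoidHom _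
    rw [map_list_prod, List.map_ofFn]
    rfl
  have h2 : pd x i = ((d i : C) : DOp x) := rfl
  rw [h, h, h2]
  change _ = ((d i * ∏ j, d j ^ α j : C) : DOp x)
  congr 1
  simp only [Pi.add_apply, pow_add, Finset.prod_mul_distrib]
  rw [mul_comm]
  congr 1
  rw [Finset.prod_eq_single i]
  · simp
  · intro j _ hj; simp [hj]
  · simp

theorem pdPow_zero {k : ℕ} (x : Pt k) : pdPow x 0 = 1 := by
  simp [pdPow, List.ofFn_const]

theorem len_add_single {k : ℕ} (α : Fin k → ℕ) (i : Fin k) :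
    len (α + Pi.single i 1) = len α + 1 := by
  simp [len, Finset.sum_add_distrib]

theorem wt_add_single {k : ℕ} (α : Fin k → ℕ) (i : Fin k) :
    wt (α + Pi.single i 1) = wt α + ((i : ℕ) + 1) := by
  simp [wt, Finset.sum_add_distrib, mul_add, Pi.single_apply]

theorem exists_eq_add_single {k : ℕ} {α : Fin k → ℕ} {i : Fin k} (h : α i ≠ 0) :
    ∃ β : Fin k → ℕ, α = β + Pi.single i 1 := by
  refine ⟨α - Pi.single i 1, ?_⟩
  funext j
  by_cases hj : j = i
  · subst hj; simp; omega
  · simp [hj]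

theorem len_le_wt {k : ℕ} (α : Fin k → ℕ) : len α ≤ wt α :=
  Finset.sum_le_sum fun _ _ => Nat.le_mul_of_pos_left _ (Nat.succ_pos _)

theorem wt_le_mul_len {k : ℕ} (α : Fin k → ℕ) : wt α ≤ k * len α := by
  rw [len, Finset.mul_sum]
  exact Finset.sum_le_sum fun i _ => Nat.mul_le_mul_right _ i.2

theorem exists_len_wt {k : ℕ} (q r : ℕ) (h1 : q ≤ r) (h2 : r ≤ k * q) :
    ∃ α : Fin k → ℕ, len α = q ∧ wt α = r := by
  induction q generalizing r with
  | zero => exact ⟨0, by simp [len], by simp [wt]; omega⟩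
  | succ q ih =>
    rw [Nat.mul_succ] at h2
    -- Split off one index: if r − q ≤ k take r − q and let the other q indices all be 1; otherwise
    -- take k.
    by_cases h : r - q ≤ k
    · obtain ⟨α, h3, h4⟩ := ih q le_rfl (by
        rcases Nat.eq_zero_or_pos k with rfl | hk
        · omega
        · exact Nat.le_mul_of_pos_left _ hk)
      refine ⟨α + Pi.single ⟨r - q - 1, by omega⟩ 1, ?_, ?_⟩
      · rw [len_add_single, h3]
      · rw [wt_add_single, h4]; simp only; omega
    · obtain ⟨α, h3, h4⟩ := ih (r - k) (by omega) (by omega)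
      have hk : k ≠ 0 := by rintro rfl; omega
      refine ⟨α + Pi.single ⟨k - 1, by omega⟩ 1, ?_, ?_⟩
      · rw [len_add_single, h3]
      · rw [wt_add_single, h4]; simp only; omega

theorem exists_ne_zero_of_len {k : ℕ} {α : Fin k → ℕ} {q : ℕ} (h : len α = q + 1) :
    ∃ i, α i ≠ 0 := by
  by_contra! h'
  have : len α = 0 := Finset.sum_eq_zero fun i _ => h' i
  omega

theorem exists_pos_index_of_len_lt_wt {k : ℕ} {α : Fin k → ℕ} (h : len α < wt α) :
    ∃ i : Fin k, 0 < (i : ℕ) ∧ α i ≠ 0 := by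
  by_contra! h'
  refine h.ne (Finset.sum_congr rfl fun i _ => ?_)
  rcases Nat.eq_zero_or_pos (i : ℕ) with hi | hi
  · simp [hi]
  · simp [h' i hi]

/-! ### The stalks of `W` -/

theorem mkQ_eq_of_opA {k : ℕ} (x : Pt k) (α : Fin k → ℕ) (i j : ℕ) (hi : i + 1 < k)
    (hj : j + 1 < k) :
    (idealA x).mkQ (pdPow x (α + Pi.single ⟨j + 1, hj⟩ 1 + Pi.single ⟨i, by omega⟩ 1)) =
      (idealA x).mkQ (pdPow x (α + Pi.single ⟨j, by omega⟩ 1 + Pi.single ⟨i + 1, hi⟩ 1)) := by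
  rw [← sub_eq_zero, ← map_sub, Submodule.mkQ_apply, Submodule.Quotient.mk_eq_zero]
  have hcomm : ∀ a : Fin k, Commute (pd x a) (pdPow x α) := by
    intro a
    refine Commute.list_prod_right _ _ fun y hy => ?_
    obtain ⟨b, rfl⟩ := (List.mem_ofFn' _ _).1 hy
    exact Commute.pow_right (pd_comm x a b) _
  have : pdPow x (α + Pi.single ⟨j + 1, hj⟩ 1 + Pi.single ⟨i, by omega⟩ 1) -
      pdPow x (α + Pi.single ⟨j, by omega⟩ 1 + Pi.single ⟨i + 1, hi⟩ 1) =
      pdPow x α • opA x i j hi hj := by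
    rw [pdPow_add_single, pdPow_add_single, pdPow_add_single, pdPow_add_single, smul_eq_mul, opA,
      mul_sub, ← mul_assoc, ← mul_assoc, ((hcomm _).mul_left (hcomm _)).eq,
      ((hcomm _).mul_left (hcomm _)).eq]
  rw [this]
  exact (idealA x).smul_mem _ (Submodule.subset_span ⟨i, j, hi, hj, rfl⟩)

/-- The class of `∂^α` in `W` depends only on the length and the weight of `α`. -/
theorem mkQ_pdPow_eq {k : ℕ} (x : Pt k) (q : ℕ) : ∀ α β : Fin k → ℕ, len α = q → len β = q →
    wt α = wt β → (idealA x).mkQ (pdPow x α) = (idealA x).mkQ (pdPow x β) := by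
  induction q with
  | zero =>
    intro α β hα hβ _
    have h0 : ∀ γ : Fin k → ℕ, len γ = 0 → γ = 0 := fun γ hγ =>
      funext fun i => by simpa using (Finset.sum_eq_zero_iff.1 hγ) i (Finset.mem_univ i)
    rw [h0 α hα, h0 β hβ]
  | succ q ih =>
    -- Induction on the distance between an index of one monomial and an index of the other: at
    -- distance 0 the common derivative is cancelled.
    have key : ∀ (d : ℕ) (α β : Fin k → ℕ) (i j : Fin k), len α = q → len β = q →
        (j : ℕ) = i + d → wt (α + Pi.single i 1) = wt (β + Pi.single j 1) →
        (idealA x).mkQ (pdPow x (α + Pi.single i 1)) =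
          (idealA x).mkQ (pdPow x (β + Pi.single j 1)) := by
      intro d
      induction d with
      | zero =>
        intro α β i j hα hβ hd hw
        obtain rfl : j = i := Fin.ext hd
        rw [wt_add_single, wt_add_single] at hw
        have := ih α β hα hβ (by omega)
        rw [pdPow_add_single, pdPow_add_single, ← smul_eq_mul, ← smul_eq_mul, map_smul, map_smul,
          this]
      | succ d ihd =>
        intro α β i j hα hβ hd hw
        have hw' := hw
        rw [wt_add_single, wt_add_single] at hw
        have h1 := len_le_wt β
        -- Equality of total weights with j > i gives wt α > wt β ≥ q = len α, so α contains some
        -- ∂_h with h > 1. A generator of A lowers that index while raising i.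
        obtain ⟨m, hm, hm'⟩ := exists_pos_index_of_len_lt_wt (α := α) (by omega)
        obtain ⟨γ, rfl⟩ := exists_eq_add_single hm'
        obtain ⟨⟨_ | m, hmk⟩, rfl⟩ : ∃ n : Fin k, m = n := ⟨m, rfl⟩
        · exact absurd hm (lt_irrefl _)
        have hj := j.2
        have hA := mkQ_eq_of_opA x γ i m (by omega) hmk
        rw [hA]
        refine ihd _ β ⟨i + 1, by omega⟩ j ?_ hβ (by simp only; omega) ?_
        · rw [← hα, len_add_single, len_add_single]
        · rw [← hw']
          simp only [wt_add_single]
          omega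
    intro α β hα hβ hw
    obtain ⟨i, hi⟩ := exists_ne_zero_of_len hα
    obtain ⟨j, hj⟩ := exists_ne_zero_of_len hβ
    obtain ⟨α, rfl⟩ := exists_eq_add_single hi
    obtain ⟨β, rfl⟩ := exists_eq_add_single hj
    rw [len_add_single] at hα hβ
    rcases le_total (i : ℕ) j with hij | hij
    · exact key (j - i) α β i j (by omega) (by omega) (by omega) hw
    · exact (key (i - j) β α j i (by omega) (by omega) (by omega) hw.symm).symm

theorem yClass_len_wt {k : ℕ} (x : Pt k) (α : Fin k → ℕ) :
    yClass x (len α) (wt α) = (idealA x).mkQ (pdPow x α) := by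
  have h : ∃ β : Fin k → ℕ, len β = len α ∧ wt β = wt α := ⟨α, rfl, rfl⟩
  rw [yClass, dif_pos h]
  exact mkQ_pdPow_eq x _ _ _ h.choose_spec.1 rfl h.choose_spec.2

theorem yClass_eq_zero {k : ℕ} (x : Pt k) {q r : ℕ} (h : ¬ (q ≤ r ∧ r ≤ k * q)) :
    yClass x q r = 0 := by
  rw [yClass, dif_neg]
  rintro ⟨α, rfl, rfl⟩
  exact h ⟨len_le_wt α, wt_le_mul_len α⟩

theorem pd_smul_yClass {k : ℕ} (x : Pt k) {q r : ℕ} (h1 : q ≤ r) (h2 : r ≤ k * q) (i : Fin k) :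
    pd x i • yClass x q r = yClass x (q + 1) (r + ((i : ℕ) + 1)) := by
  obtain ⟨α, rfl, rfl⟩ := exists_len_wt q r h1 h2
  rw [← len_add_single α i, ← wt_add_single, yClass_len_wt, yClass_len_wt, pdPow_add_single,
    ← smul_eq_mul, map_smul]

theorem exists_mkQ_eq_yClass {k : ℕ} (x : Pt k) {q r : ℕ} (h1 : q ≤ r) (h2 : r ≤ k * q) :
    ∃ α : Fin k → ℕ, len α = q ∧ wt α = r ∧ yClass x q r = (idealA x).mkQ (pdPow x α) := by
  obtain ⟨α, rfl, rfl⟩ := exists_len_wt q r h1 h2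
  exact ⟨α, rfl, rfl, yClass_len_wt x α⟩

/-! ### Linear independence of the classes y_{q,r} -/

theorem toEnd_pdPow_expGerm {k : ℕ} (x : Pt k) (u t : ℂ) (α : Fin k → ℕ) :
    toEnd x (pdPow x α) (expGerm x u t) = (u ^ len α * t ^ wt α) • expGerm x u t := by
  generalize hq : len α = q
  induction q generalizing α with
  | zero =>
    have h0 : α = 0 :=
      funext fun i => by simpa using (Finset.sum_eq_zero_iff.1 hq) i (Finset.mem_univ i)
    subst h0
    rw [pdPow_zero, map_one]
    simp [wt]
  | succ q ih =>
    obtain ⟨i, hi⟩ := exists_ne_zero_of_len hq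
    obtain ⟨α, rfl⟩ := exists_eq_add_single hi
    rw [len_add_single] at hq
    rw [pdPow_add_single, map_mul, Module.End.mul_apply, ih α (by omega), map_smul, toEnd_pd,
      pderivEnd_expGerm, smul_smul, wt_add_single]
    congr 1
    ring

/-- The exponential is a joint eigenvector of the ∂_h, with eigenvalues u t^h, and both terms of
each generator of A have the same eigenvalue. -/
theorem toEnd_idealA_expGerm {k : ℕ} (x : Pt k) (u t : ℂ) {P : DOp x} (hP : P ∈ idealA x) :
    toEnd x P (expGerm x u t) = 0 := by
  induction hP using Submodule.span_induction with
  | mem P hP =>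
    obtain ⟨i, j, hi, hj, rfl⟩ := hP
    simp only [opA, map_sub, map_mul, LinearMap.sub_apply, Module.End.mul_apply, toEnd_pd,
      pderivEnd_expGerm, map_smul, smul_smul]
    rw [sub_eq_zero]
    congr 1
    ring
  | zero => simp
  | add P Q _ _ h1 h2 => rw [map_add, LinearMap.add_apply, h1, h2, add_zero]
  | smul P Q _ h => rw [smul_eq_mul, map_mul, Module.End.mul_apply, h, map_zero]

/-- The pairs `(q, r)` for which the class `y_{q,r}` is defined. -/
abbrev YIdx (k : ℕ) : Type := {p : ℕ × ℕ // p.1 ≤ p.2 ∧ p.2 ≤ k * p.1}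

-- A relation lifts to an operator in A. Applied to exp(u ∑ σ_h t^h), it says that a polynomial in
-- u, t over O vanishes at all complex u and t; as O is a domain containing ℂ, its coefficients
-- vanish.
open Polynomial in
theorem yClass_linearIndependent {k : ℕ} (x : Pt k) :
    LinearIndependent (HolGerm x) (fun p : YIdx k => yClass x p.1.1 p.1.2) := by
  rw [linearIndependent_iff']
  intro s g hg
  choose α h1 h2 h3 using fun p : YIdx k => exists_mkQ_eq_yClass x p.2.1 p.2.2
  have hmem : (∑ p ∈ s, g p • pdPow x (α p)) ∈ idealA x := by
    rw [← Submodule.Quotient.mk_eq_zero, ← Submodule.mkQ_apply, map_sum, ← hg]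
    refine Finset.sum_congr rfl fun p _ => ?_
    rw [h3]
    rfl
  have hinf : (Set.range (algebraMap ℂ (HolGerm x))).Infinite :=
    Set.infinite_range_of_injective (FaithfulSMul.algebraMap_injective ℂ (HolGerm x))
  have hev : ∀ u t : ℂ, ∑ p ∈ s, g p * (algebraMap ℂ (HolGerm x) u ^ p.1.1 *
      algebraMap ℂ (HolGerm x) t ^ p.1.2) = 0 := by
    intro u t
    have := toEnd_idealA_expGerm x u t hmem
    rw [map_sum, LinearMap.sum_apply] at this
    have h4 : ∀ p ∈ s, toEnd x (g p • pdPow x (α p)) (expGerm x u t) =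
        g p * (algebraMap ℂ (HolGerm x) u ^ p.1.1 * algebraMap ℂ (HolGerm x) t ^ p.1.2) *
          expGerm x u t := by
      intro p _
      rw [hol_smul_def, map_mul, Module.End.mul_apply, toEnd_ofHol, toEnd_pdPow_expGerm, h1, h2,
        Algebra.smul_def, map_mul, map_pow, map_pow]
      ring
    rw [Finset.sum_congr rfl h4, ← Finset.sum_mul] at this
    exact (mul_eq_zero.1 this).resolve_right (expGerm_ne_zero x u t)
  -- The outer variable is u and the inner one is t. Specializing t leaves a polynomial in u with
  -- infinitely many roots; then each coefficient has infinitely many roots in t.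
  let F : (HolGerm x)[X][X] := ∑ p ∈ s, monomial p.1.1 (monomial p.1.2 (g p))
  have hF : F = 0 := by
    ext1 q
    rw [coeff_zero]
    refine eq_zero_of_infinite_isRoot _ (hinf.mono ?_)
    rintro _ ⟨t, rfl⟩
    have hmap : F.map (evalRingHom (algebraMap ℂ (HolGerm x) t)) = 0 := by
      refine eq_zero_of_infinite_isRoot _ (hinf.mono ?_)
      rintro _ ⟨u, rfl⟩
      change eval _ _ = 0
      rw [← hev u t]
      simp only [F, Polynomial.map_sum, eval_finsetSum, map_monomial, eval_monomial,
        coe_evalRingHom]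
      exact Finset.sum_congr rfl fun p _ => by ring
    have := congrArg (fun G => coeff G q) hmap
    simpa [coeff_map] using this
  intro p hp
  have := congrArg (fun G => coeff (coeff G p.1.1) p.1.2) hF
  simp only [F, finsetSum_coeff, coeff_monomial, coeff_zero] at this
  rw [Finset.sum_eq_single p] at this
  · simpa using this
  · rintro ⟨⟨a, b⟩, hab⟩ _ hne
    by_cases h : a = p.1.1
    · have hb : b ≠ p.1.2 := fun hb => hne (Subtype.ext (Prod.ext h hb))
      simp [h, hb, coeff_monomial]
    · simp [h]
  · exact fun h => absurd hp h

theorem span_yClass {k : ℕ} (x : Pt k) :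
    Submodule.span (HolGerm x) (Set.range fun p : YIdx k => yClass x p.1.1 p.1.2) = ⊤ := by
  rw [eq_top_iff]
  rintro w -
  obtain ⟨P, rfl⟩ := (idealA x).mkQ_surjective w
  have h1 : (idealA x).mkQ P = P • yClass x 0 0 := by
    have := yClass_len_wt x 0
    rw [show len (0 : Fin k → ℕ) = 0 by simp [len], show wt (0 : Fin k → ℕ) = 0 by simp [wt],
      pdPow_zero] at this
    rw [this, ← map_smul, smul_eq_mul, mul_one]
  rw [h1]
  refine dop_smul_mem _ (pd_smul_mem_span ?_) P _ (Submodule.subset_span ⟨⟨(0, 0), by simp⟩, rfl⟩)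
  rintro i _ ⟨⟨⟨q, r⟩, h⟩, rfl⟩
  have hi := i.2
  rw [pd_smul_yClass x h.1 h.2 i]
  exact Submodule.subset_span ⟨⟨(q + 1, r + ((i : ℕ) + 1)), by
    simp only [Nat.mul_succ] at h ⊢; omega⟩, rfl⟩

/-- The classes `y_{q,r}` form a basis of the stalk of `W`. -/
def yBasis {k : ℕ} (x : Pt k) : Module.Basis (YIdx k) (HolGerm x) (WStalk x) :=
  Module.Basis.mk (yClass_linearIndependent x) (span_yClass x).ge

theorem yBasis_apply {k : ℕ} (x : Pt k) (p : YIdx k) : yBasis x p = yClass x p.1.1 p.1.2 :=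
  Module.Basis.mk_apply _ _ _

section Poly

open Polynomial

/-! ### Polynomials with support in an interval -/

/-- The polynomials whose exponents lie in `[m, n]`. -/
def psupp (S : Type*) [CommRing S] (m n : ℕ) : Submodule S S[X] where
  carrier := {p | ∀ i, i < m ∨ n < i → p.coeff i = 0}
  zero_mem' := fun _ _ => coeff_zero _
  add_mem' := fun ha hb i hi => by rw [coeff_add, ha i hi, hb i hi, add_zero]
  smul_mem' := fun c p hp i hi => by rw [coeff_smul, hp i hi, smul_zero]

variable {S : Type*} [CommRing S]

theorem mem_psupp {m n : ℕ} {p : S[X]} : p ∈ psupp S m n ↔ ∀ i, i < m ∨ n < i → p.coeff i = 0 :=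
  Iff.rfl

theorem monomial_mem_psupp {m n r : ℕ} (a : S) (h1 : m ≤ r) (h2 : r ≤ n) :
    monomial r a ∈ psupp S m n := fun i hi => by
  rw [coeff_monomial, if_neg (by omega)]

theorem psupp_mono {m n m' n' : ℕ} (hm : m' ≤ m) (hn : n ≤ n') : psupp S m n ≤ psupp S m' n' :=
  fun _ hp i hi => hp i (by omega)

theorem mul_mem_psupp {m n m' n' : ℕ} {p p' : S[X]} (hp : p ∈ psupp S m n)
    (hp' : p' ∈ psupp S m' n') : p * p' ∈ psupp S (m + m') (n + n') := by
  intro i hi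
  rw [coeff_mul]
  refine Finset.sum_eq_zero fun ij hij => ?_
  have hij : ij.1 + ij.2 = i := Finset.HasAntidiagonal.mem_antidiagonal.1 hij
  by_cases h : ij.1 < m ∨ n < ij.1
  · rw [hp _ h, zero_mul]
  · rw [hp' _ (by omega), mul_zero]

/-- The lower bound holds because R is prime to t, the upper one because degrees add over a domain.
-/
theorem mem_psupp_of_mul_mem [IsDomain S] {m n k : ℕ} {c R : S[X]} (h0 : R.coeff 0 = 1)
    (hk : R.natDegree = k) (h : c * R ∈ psupp S m (n + k)) : c ∈ psupp S m n := by
  have hR : R ≠ 0 := by rintro rfl; simp at h0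
  intro i hi
  by_cases hc : c = 0
  · simp [hc]
  rcases hi with hi | hi
  · have h1 : X ^ m ∣ c * R := X_pow_dvd_iff.2 fun d hd => h d (Or.inl hd)
    have h2 : IsCoprime (X : S[X]) R := by
      obtain ⟨T, hT⟩ := X_dvd_iff.2 (show (R - 1).coeff 0 = 0 by simp [h0])
      exact ⟨-T, 1, by linear_combination hT⟩
    exact X_pow_dvd_iff.1 (h2.pow_left.dvd_of_dvd_mul_right h1) i hi
  · refine coeff_eq_zero_of_natDegree_lt ?_
    have h1 : (c * R).natDegree ≤ n + k := by
      rw [natDegree_le_iff_coeff_eq_zero]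
      exact fun j hj => h j (Or.inr hj)
    rw [natDegree_mul hc hR] at h1
    omega

/-- The operator `t d/dt - a` on polynomials in `t`. -/
def eulerSub (a : S) : S[X] →ₗ[S] S[X] where
  toFun p := X * derivative p - C a * p
  map_add' p p' := by rw [map_add]; ring
  map_smul' c p := by
    rw [RingHom.id_apply, derivative_smul]; simp only [smul_eq_C_mul]; ring

theorem eulerSub_apply (a : S) (p : S[X]) : eulerSub a p = X * derivative p - C a * p := rfl

theorem coeff_eulerSub (a : S) (p : S[X]) (i : ℕ) :
    (eulerSub a p).coeff i = (i - a) * p.coeff i := by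
  rw [eulerSub_apply, coeff_sub, coeff_C_mul]
  cases i with
  | zero => simp
  | succ i => rw [coeff_X_mul, coeff_derivative]; push_cast; ring

theorem eulerSub_mem_psupp {a : S} {m n : ℕ} {p : S[X]} (hp : p ∈ psupp S m n) :
    eulerSub a p ∈ psupp S m n := fun i hi => by rw [coeff_eulerSub, hp i hi, mul_zero]

theorem eulerSub_mul (a : S) (c R : S[X]) :
    eulerSub a (c * R) = eulerSub a c * R + c * (X * derivative R) := by
  simp only [eulerSub_apply, derivative_mul]; ring

theorem eulerSub_monomial (a b : S) (r : ℕ) :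
    eulerSub a (monomial r b) = monomial r ((r - a) * b) := by
  ext i
  rw [coeff_eulerSub, coeff_monomial, coeff_monomial]
  split_ifs with h
  · rw [h]
  · rw [mul_zero]

theorem eq_zero_of_eulerSub [IsDomain S] {a : S} {m n : ℕ} (ha : ∀ i : ℕ, m ≤ i → i ≤ n → a ≠ i)
    {p : S[X]} (hp : p ∈ psupp S m n) (h : eulerSub a p = 0) : p = 0 := by
  ext i
  by_cases hi : i < m ∨ n < i
  · simpa using hp i hi
  · have h1 := coeff_eulerSub a p i
    rw [h, coeff_zero, eq_comm, mul_eq_zero] at h1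
    simpa using h1.resolve_left (sub_ne_zero.2 (ha i (by omega) (by omega)).symm)

theorem exists_eulerSub_eq {a : S} {m n : ℕ}
    (ha : ∀ i : ℕ, m ≤ i → i ≤ n → IsUnit ((i : S) - a)) {p : S[X]} (hp : p ∈ psupp S m n) :
    ∃ c ∈ psupp S m n, eulerSub a c = p := by
  let c : S[X] := ∑ i ∈ Finset.Icc m n, monomial i (Ring.inverse ((i : S) - a) * p.coeff i)
  have hc : ∀ i, c.coeff i = if m ≤ i ∧ i ≤ n then Ring.inverse ((i : S) - a) * p.coeff i else 0 := by
    intro i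
    simp only [c, finsetSum_coeff, coeff_monomial]
    rw [Finset.sum_ite_eq']
    simp
  refine ⟨c, fun i hi => ?_, ?_⟩
  · rw [hc, if_neg (by omega)]
  · ext i
    rw [coeff_eulerSub, hc]
    split_ifs with h
    · rw [← mul_assoc, Ring.mul_inverse_cancel _ (ha i h.1 h.2), one_mul]
    · rw [mul_zero, hp i (by omega)]

/-! ### Syzygies between a polynomial and its derivative -/

/-- Modulo δ the polynomial R still has constant term 1, so it is invertible as a power series and c
vanishes modulo δ. Then δ cancels, with no factoriality of S involved. -/
theorem dvd_of_C_mul_eq_mul [IsDomain S] {δ : S} (hδ : δ ≠ 0) {R p c : S[X]} (hR : R.coeff 0 = 1)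
    (h : C δ * p = R * c) : R ∣ p := by
  let f := Ideal.Quotient.mk (Ideal.span {δ})
  have hf : f δ = 0 := Ideal.Quotient.eq_zero_iff_mem.2 (Ideal.mem_span_singleton_self δ)
  have h1 : R.map f * c.map f = 0 := by
    rw [← Polynomial.map_mul, ← h, Polynomial.map_mul, map_C, hf, C_0, zero_mul]
  have hu : IsUnit ((R.map f : (S ⧸ Ideal.span {δ})[X]) : PowerSeries (S ⧸ Ideal.span {δ})) := by
    rw [PowerSeries.isUnit_iff_constantCoeff]
    simp [← PowerSeries.coeff_zero_eq_constantCoeff_apply, hR]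
  have h2 : c.map f = 0 := by
    rw [← Polynomial.coe_inj, Polynomial.coe_zero, ← hu.mul_right_eq_zero, ← Polynomial.coe_mul, h1,
      Polynomial.coe_zero]
  have h3 : C δ ∣ c := by
    rw [C_dvd_iff_dvd_coeff]
    intro i
    rw [← Ideal.mem_span_singleton, ← Ideal.Quotient.eq_zero_iff_mem]
    simpa using congrArg (fun g => coeff g i) h2
  obtain ⟨c, rfl⟩ := h3
  refine ⟨c, mul_left_cancel₀ (C_ne_zero.2 hδ) ?_⟩
  rw [h]; ring

/-- Multiplying the Bézout identity by bX and using the syzygy shows that R divides δbX. The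
preceding lemma removes δ, and comparing constant terms removes X. -/
theorem exists_of_mul_add_mul_derivative_eq_zero [IsDomain S] {δ : S} (hδ : δ ≠ 0)
    {R A B a b : S[X]} (hR : R.coeff 0 = 1) (h : R * A + derivative R * B = C δ)
    (hab : a * R + b * (X * derivative R) = 0) :
    ∃ c, b = -(c * R) ∧ a = c * (X * derivative R) := by
  have hR0 : R ≠ 0 := by rintro rfl; simp at hR
  obtain ⟨e, he⟩ := dvd_of_C_mul_eq_mul (p := b * X) (c := A * b * X - B * a) hδ hR (by
    linear_combination (-b * X) * h + B * hab)
  have h0 : e.coeff 0 = 0 := by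
    have := congrArg (fun g => coeff g 0) he
    simpa [mul_coeff_zero, hR] using this.symm
  obtain ⟨c, rfl⟩ := X_dvd_iff.2 h0
  have hb : b = R * c := mul_left_cancel₀ (X_ne_zero (R := S)) (by linear_combination he)
  refine ⟨-c, by rw [hb]; ring, mul_right_cancel₀ hR0 ?_⟩
  linear_combination hab - X * derivative R * hb

/-- The polynomial `1 + ∑_h σ_h t^h`. -/
def unitPoly {k : ℕ} (s : Fin k → S) : S[X] := 1 + ∑ h : Fin k, monomial ((h : ℕ) + 1) (s h)

theorem unitPoly_map {T : Type*} [CommRing T] {k : ℕ} (s : Fin k → S) (f : S →+* T) :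
    (unitPoly s).map f = unitPoly fun h => f (s h) := by
  simp [unitPoly, Polynomial.map_sum]

theorem coeff_zero_unitPoly {k : ℕ} (s : Fin k → S) : (unitPoly s).coeff 0 = 1 := by
  simp [unitPoly, coeff_monomial]

theorem unitPoly_mem_psupp {k : ℕ} (s : Fin k → S) : unitPoly s ∈ psupp S 0 k := by
  refine Submodule.add_mem _ (monomial_mem_psupp (r := 0) 1 le_rfl (Nat.zero_le k))
    (Submodule.sum_mem _ fun h _ => monomial_mem_psupp _ (Nat.zero_le _) h.2)

theorem X_mul_derivative_unitPoly {k : ℕ} (s : Fin k → S) :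
    X * derivative (unitPoly s) = ∑ h : Fin k, monomial ((h : ℕ) + 1) (((h : ℕ) + 1 : S) * s h) := by
  simp only [unitPoly, derivative_add, derivative_one, zero_add, derivative_sum, Finset.mul_sum,
    derivative_monomial, X_mul_monomial]
  refine Finset.sum_congr rfl fun h _ => ?_
  rw [mul_comm (s h)]
  simp

theorem X_mul_derivative_unitPoly_mem_psupp {k : ℕ} (s : Fin k → S) :
    X * derivative (unitPoly s) ∈ psupp S 1 k := by
  rw [X_mul_derivative_unitPoly]
  exact Submodule.sum_mem _ fun h _ => monomial_mem_psupp _ (by omega) h.2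

theorem coeff_unitPoly {k : ℕ} (s : Fin k → S) (h : Fin k) :
    (unitPoly s).coeff ((h : ℕ) + 1) = s h := by
  rw [unitPoly, coeff_add, finsetSum_coeff, Finset.sum_eq_single h]
  · simp [coeff_one]
  · intro j _ hj
    rw [coeff_monomial, if_neg]
    exact fun e => hj (Fin.ext (by omega))
  · simp

theorem natDegree_unitPoly {k : ℕ} (hk : 0 < k) (s : Fin k → S) (hs : s ⟨k - 1, by omega⟩ ≠ 0) :
    (unitPoly s).natDegree = k := by
  refine le_antisymm ?_ (le_natDegree_of_ne_zero ?_)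
  · rw [natDegree_le_iff_coeff_eq_zero]
    exact fun j hj => unitPoly_mem_psupp s j (Or.inr hj)
  · have := coeff_unitPoly s ⟨k - 1, by omega⟩
    simp only [Nat.sub_add_cancel hk] at this
    rwa [this]

/-- The generic polynomial `1 + ∑_h σ_h t^h` has a nonzero discriminant. -/
theorem exists_unitPoly_bezout {k : ℕ} (hk : 0 < k) :
    ∃ (δ : MvPolynomial (Fin k) ℂ) (A B : (MvPolynomial (Fin k) ℂ)[X]), δ ≠ 0 ∧
      unitPoly MvPolynomial.X * A + derivative (unitPoly MvPolynomial.X) * B = C δ := by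
  have hdeg : (unitPoly (MvPolynomial.X : Fin k → MvPolynomial (Fin k) ℂ)).natDegree ≤ k :=
    (natDegree_unitPoly hk _ (MvPolynomial.X_ne_zero _)).le
  have hdeg' := (natDegree_derivative_le (unitPoly (MvPolynomial.X (R := ℂ) (σ := Fin k)))).trans
    (Nat.sub_le_sub_right hdeg 1)
  obtain ⟨A, B, _, _, e⟩ := exists_mul_add_mul_eq_C_resultant _ _ hdeg hdeg' (Or.inl hk.ne')
  refine ⟨_, A, B, fun h0 => ?_, e⟩
  -- The resultant is nonzero because it specializes to that of the separable polynomial 1 + t^k and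
  -- its derivative.
  let v : Fin k → ℂ := fun i => if (i : ℕ) + 1 = k then 1 else 0
  let φ : MvPolynomial (Fin k) ℂ →+* ℂ := MvPolynomial.eval v
  have hv : (unitPoly MvPolynomial.X).map φ = 1 + X ^ k := by
    rw [unitPoly_map, unitPoly, Finset.sum_eq_single (⟨k - 1, by omega⟩ : Fin k)]
    · simp [φ, v, Nat.sub_add_cancel hk, ← C_mul_X_pow_eq_monomial]
    · intro j _ hj
      have : (j : ℕ) + 1 ≠ k := fun e => hj (Fin.ext (by simp only; omega))
      simp [φ, v, this]
    · simp
  have hd : (1 + X ^ k : ℂ[X]).natDegree = k := by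
    rw [add_comm]; exact natDegree_X_pow_add_C (r := (1 : ℂ))
  have hder : derivative (1 + X ^ k : ℂ[X]) = C (k : ℂ) * X ^ (k - 1) := by
    simp [derivative_X_pow]
  have hkc : (k : ℂ) ≠ 0 := Nat.cast_ne_zero.2 hk.ne'
  have hd' : (derivative (1 + X ^ k : ℂ[X])).natDegree = k - 1 := by
    rw [hder, natDegree_C_mul_X_pow _ _ hkc]
  have h1 := resultant_map_map (unitPoly MvPolynomial.X) (derivative (unitPoly MvPolynomial.X))
    k (k - 1) φ
  rw [h0, map_zero, ← derivative_map, hv] at h1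
  refine resultant_ne_zero (1 + X ^ k : ℂ[X]) (derivative (1 + X ^ k)) ?_ ?_
  · refine ⟨1, -(C (k : ℂ)⁻¹ * X), ?_⟩
    have hX : (X : ℂ[X]) ^ k = X ^ (k - 1) * X := by rw [← pow_succ, Nat.sub_add_cancel hk]
    have hC : C (k : ℂ)⁻¹ * C (k : ℂ) = 1 := by rw [← C_mul, inv_mul_cancel₀ hkc, C_1]
    rw [hder, hX]
    linear_combination (-(X : ℂ[X]) ^ (k - 1) * X) * hC
  · rw [hd, hd', h1]

/-- The polynomial `1 + ∑_h σ_h t^h` over the ring of germs of holomorphic functions. -/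
def sigPoly {k : ℕ} (x : Pt k) : (HolGerm x)[X] := unitPoly (coord x)

theorem coord_ne_zero {k : ℕ} (x : Pt k) (i : Fin k) : coord x i ≠ 0 := by
  have := (aeval_coord_injective x).ne (MvPolynomial.X_ne_zero (R := ℂ) i)
  simpa using this

/-- The discriminant is a nonzero polynomial in the σ_h, so its germ is nonzero at every x, even
where it takes the value 0. No genericity of x is needed. -/
theorem sigPoly_syzygy {k : ℕ} (hk : 0 < k) (x : Pt k) {a b : (HolGerm x)[X]}
    (hab : a * sigPoly x + b * (X * derivative (sigPoly x)) = 0) :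
    ∃ c, b = -(c * sigPoly x) ∧ a = c * (X * derivative (sigPoly x)) := by
  obtain ⟨δ, A, B, hδ, e⟩ := exists_unitPoly_bezout hk
  let φ : MvPolynomial (Fin k) ℂ →+* HolGerm x := (MvPolynomial.aeval (coord x)).toRingHom
  have hφ : (unitPoly MvPolynomial.X).map φ = sigPoly x := by
    rw [unitPoly_map, sigPoly]
    congr 1
    funext h
    exact MvPolynomial.aeval_X _ _
  have e' := congrArg (Polynomial.map φ) e
  rw [Polynomial.map_add, Polynomial.map_mul, Polynomial.map_mul, ← derivative_map, hφ, map_C] at e'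
  refine exists_of_mul_add_mul_derivative_eq_zero ?_ (coeff_zero_unitPoly _) e' hab
  exact fun h => hδ ((injective_iff_map_eq_zero _).1 (aeval_coord_injective x) δ h)

end Poly

section Stalk

open Polynomial

/-! ### Generating polynomials of elements of `W` -/

/-- The `O_{N,x}`-linear map with `t^r ↦ y_{q,r}`. -/
def yPoly {k : ℕ} (x : Pt k) (q : ℕ) : (HolGerm x)[X] →ₗ[HolGerm x] WStalk x :=
  Polynomial.lsum fun r => LinearMap.toSpanSingleton (HolGerm x) (WStalk x) (yClass x q r)

theorem yPoly_monomial {k : ℕ} (x : Pt k) (q r : ℕ) (a : HolGerm x) :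
    yPoly x q (monomial r a) = a • yClass x q r := by
  rw [yPoly, Polynomial.lsum_apply, sum_monomial_index] <;> simp

/-- The generating polynomial of the degree `q` component of an element of `W`. -/
def yCoeff {k : ℕ} (x : Pt k) (q : ℕ) : WStalk x →ₗ[HolGerm x] (HolGerm x)[X] :=
  (yBasis x).constr (HolGerm x) fun p => if p.1.1 = q then monomial p.1.2 1 else 0

theorem yCoeff_yClass {k : ℕ} (x : Pt k) (q : ℕ) {q' r : ℕ} (h1 : q' ≤ r) (h2 : r ≤ k * q') :
    yCoeff x q (yClass x q' r) = if q' = q then monomial r 1 else 0 := by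
  rw [← yBasis_apply x ⟨(q', r), h1, h2⟩, yCoeff, Module.Basis.constr_basis]

theorem yCoeff_yPoly {k : ℕ} (x : Pt k) (q : ℕ) {q' : ℕ} {p : (HolGerm x)[X]}
    (hp : p ∈ psupp (HolGerm x) q' (k * q')) :
    yCoeff x q (yPoly x q' p) = if q' = q then p else 0 := by
  have h : yCoeff x q (yPoly x q' p) =
      ∑ i ∈ p.support, p.coeff i • (if q' = q then monomial i (1 : HolGerm x) else 0) := by
    conv_lhs => rw [p.as_sum_support]
    rw [map_sum, map_sum]
    refine Finset.sum_congr rfl fun i hi => ?_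
    rw [yPoly_monomial, map_smul]
    have hi' := mem_support_iff.1 hi
    rw [yCoeff_yClass]
    · by_contra h; exact hi' (hp i (Or.inl (by omega)))
    · by_contra h; exact hi' (hp i (Or.inr (by omega)))
  rw [h]
  split_ifs
  · conv_rhs => rw [p.as_sum_support]
    simp [smul_monomial]
  · simp

/-! ### The submodule of relations -/

variable {k : ℕ} (x : Pt k) (μ lam : ℂ)

/-- The logarithmic derivative numerator `∑_h h σ_h t^h` of `1 + ∑_h σ_h t^h`. -/
def sigPoly' : (HolGerm x)[X] := X * derivative (sigPoly x)

/-- The operator `t d/dt - λ`. -/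
abbrev eulerLam : (HolGerm x)[X] →ₗ[HolGerm x] (HolGerm x)[X] :=
  eulerSub (algebraMap ℂ (HolGerm x) lam)

/-- The relations coming from the operators `T_μ^m`. -/
def relT (q : ℕ) : (HolGerm x)[X] →ₗ[HolGerm x] WStalk x :=
  yPoly x (q + 1) ∘ₗ LinearMap.mulRight (HolGerm x) (sigPoly x) +
    algebraMap ℂ (HolGerm x) (q + μ) • yPoly x q

/-- The relations coming from the operator `U_0 - λ`. -/
def relU (q : ℕ) : (HolGerm x)[X] →ₗ[HolGerm x] WStalk x :=
  yPoly x (q + 1) ∘ₗ LinearMap.mulRight (HolGerm x) (sigPoly' x) + yPoly x q ∘ₗ eulerLam x lam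

/-- The linear map with `t^r ↦ θ_{q+1,r}`. -/
def relTheta (q : ℕ) : (HolGerm x)[X] →ₗ[HolGerm x] WStalk x :=
  yPoly x (q + 1) ∘ₗ (LinearMap.mulRight (HolGerm x) (sigPoly x) ∘ₗ eulerLam x lam -
    algebraMap ℂ (HolGerm x) (q + μ) • LinearMap.mulRight (HolGerm x) (sigPoly' x))

theorem relT_apply (q : ℕ) (a : (HolGerm x)[X]) : relT x μ q a =
    yPoly x (q + 1) (a * sigPoly x) + algebraMap ℂ (HolGerm x) (q + μ) • yPoly x q a := rfl

theorem relU_apply (q : ℕ) (b : (HolGerm x)[X]) : relU x lam q b =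
    yPoly x (q + 1) (b * sigPoly' x) + yPoly x q (eulerLam x lam b) := rfl

theorem relTheta_apply (q : ℕ) (c : (HolGerm x)[X]) : relTheta x μ lam q c =
    yPoly x (q + 1) (eulerLam x lam c * sigPoly x -
      algebraMap ℂ (HolGerm x) (q + μ) • (c * sigPoly' x)) := rfl

/-- The components of degree q of the two relations cancel, which is why θ is a relation
concentrated in degree q+1. -/
theorem relTheta_eq (q : ℕ) (c : (HolGerm x)[X]) : relTheta x μ lam q c =
    relT x μ q (eulerLam x lam c) - algebraMap ℂ (HolGerm x) (q + μ) • relU x lam q c := by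
  rw [relTheta_apply, relT_apply, relU_apply, map_sub, map_smul, smul_add]
  abel

theorem monomial_mul_sigPoly (r : ℕ) : monomial r 1 * sigPoly x =
    monomial r 1 + ∑ h : Fin k, monomial (r + ((h : ℕ) + 1)) (coord x h) := by
  simp [sigPoly, unitPoly, mul_add, Finset.mul_sum, monomial_mul_monomial]

theorem monomial_mul_sigPoly' (r : ℕ) : monomial r 1 * sigPoly' x =
    ∑ h : Fin k, monomial (r + ((h : ℕ) + 1)) (((h : ℕ) + 1 : HolGerm x) * coord x h) := by
  simp [sigPoly', sigPoly, X_mul_derivative_unitPoly, Finset.mul_sum, monomial_mul_monomial]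

theorem relT_monomial (q r : ℕ) : relT x μ q (monomial r 1) =
    yClass x (q + 1) r + ∑ h : Fin k, coord x h • yClass x (q + 1) (r + ((h : ℕ) + 1)) +
      algebraMap ℂ (HolGerm x) (q + μ) • yClass x q r := by
  rw [relT_apply, monomial_mul_sigPoly, map_add, map_sum]
  simp only [yPoly_monomial, one_smul]

theorem relU_monomial (q r : ℕ) : relU x lam q (monomial r 1) =
    ∑ h : Fin k, (((h : ℕ) + 1 : HolGerm x) * coord x h) • yClass x (q + 1) (r + ((h : ℕ) + 1)) +
      algebraMap ℂ (HolGerm x) (r - lam) • yClass x q r := by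
  rw [relU_apply, monomial_mul_sigPoly', map_sum, eulerSub_monomial]
  simp only [yPoly_monomial, mul_one, map_sub, map_natCast, sub_smul]

theorem relTheta_monomial (q r : ℕ) :
    relTheta x μ lam q (monomial r 1) = thetaStalk μ lam (q + 1) r x := by
  rw [relTheta_apply, eulerSub_monomial, mul_one, map_sub, map_smul, monomial_mul_sigPoly', map_sum,
    thetaStalk]
  have : monomial r ((r : HolGerm x) - algebraMap ℂ (HolGerm x) lam) =
      (algebraMap ℂ (HolGerm x) (r - lam)) • monomial r (1 : HolGerm x) := by
    rw [smul_monomial, smul_eq_mul, mul_one, map_sub (algebraMap ℂ _), map_natCast]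
  rw [this, smul_mul_assoc, map_smul, monomial_mul_sigPoly, map_add, map_sum, smul_add,
    Finset.smul_sum, Finset.smul_sum, add_sub_assoc, ← Finset.sum_sub_distrib]
  simp only [yPoly_monomial, one_smul, smul_smul, ← sub_smul]
  congr 1
  refine Finset.sum_congr rfl fun h _ => ?_
  congr 1
  simp only [map_sub, map_mul, map_add, map_natCast, map_one, Nat.cast_add, Nat.cast_one]
  ring

/-- The generators of the module of relations. -/
def relSet : Set (WStalk x) :=
  {w | ∃ q r, q + 1 ≤ r ∧ r ≤ k * q ∧ w = relT x μ q (monomial r 1)} ∪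
    {w | ∃ q r, q ≤ r ∧ r ≤ k * q ∧ w = relU x lam q (monomial r 1)}

/-- The kernel of the map from `W` to `N_{μ,λ}`. -/
def relSpan : Submodule (HolGerm x) (WStalk x) := Submodule.span (HolGerm x) (relSet x μ lam)

/-- The extra term comes from ∂_i acting on its own coordinate. For constant coefficients 1 it turns
q+μ into q+1+μ, and for coefficients h it turns r−λ into r+i−λ, so derivatives of relations are
relations. -/
theorem pd_smul_sum_coord (a : Fin k → ℂ) (q r : ℕ) (h1 : q ≤ r + 1) (h2 : r + k ≤ k * q)
    (i : Fin k) :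
    pd x i • ∑ h : Fin k, (algebraMap ℂ (HolGerm x) (a h) * coord x h) •
        yClass x q (r + ((h : ℕ) + 1)) =
      ∑ h : Fin k, (algebraMap ℂ (HolGerm x) (a h) * coord x h) •
        yClass x (q + 1) (r + ((i : ℕ) + 1) + ((h : ℕ) + 1)) +
      algebraMap ℂ (HolGerm x) (a i) • yClass x q (r + ((i : ℕ) + 1)) := by
  have : ∀ h : Fin k, pd x i • (algebraMap ℂ (HolGerm x) (a h) * coord x h) •
      yClass x q (r + ((h : ℕ) + 1)) =
      (algebraMap ℂ (HolGerm x) (a h) * coord x h) •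
        yClass x (q + 1) (r + ((i : ℕ) + 1) + ((h : ℕ) + 1)) +
      if i = h then algebraMap ℂ (HolGerm x) (a h) • yClass x q (r + ((h : ℕ) + 1)) else 0 := by
    intro h
    have hh := h.2
    rw [pd_smul_hol_smul, pd_smul_yClass x (by omega) (by omega), pderivEnd_mul, pderivEnd_coord,
      pderivEnd_algebraMap, zero_mul, add_zero]
    congr 1
    · rw [add_right_comm]
    · split_ifs <;> simp
  rw [Finset.smul_sum, Finset.sum_congr rfl fun h _ => this h, Finset.sum_add_distrib]
  simp

theorem pd_smul_relT {q r : ℕ} (h1 : q + 1 ≤ r) (h2 : r ≤ k * q) (i : Fin k) :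
    pd x i • relT x μ q (monomial r 1) = relT x μ (q + 1) (monomial (r + ((i : ℕ) + 1)) 1) := by
  have hk : k * (q + 1) = k * q + k := Nat.mul_succ _ _
  have := pd_smul_sum_coord x (fun _ => 1) (q + 1) r (by omega) (by omega) i
  simp only [map_one, one_mul, one_smul] at this
  rw [relT_monomial, relT_monomial, smul_add, smul_add, this, pd_smul_yClass x (by omega) (by omega),
    pd_smul_hol_smul, pd_smul_yClass x (by omega) (by omega), pderivEnd_algebraMap, zero_smul,
    add_zero, Nat.cast_succ, add_right_comm (q : ℂ) 1 μ, map_add _ _ (1 : ℂ), add_smul, map_one,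
    one_smul]
  abel

theorem pd_smul_relU {q r : ℕ} (h1 : q ≤ r) (h2 : r ≤ k * q) (i : Fin k) :
    pd x i • relU x lam q (monomial r 1) = relU x lam (q + 1) (monomial (r + ((i : ℕ) + 1)) 1) := by
  have hk : k * (q + 1) = k * q + k := Nat.mul_succ _ _
  have := pd_smul_sum_coord x (fun h => ((h : ℕ) + 1 : ℂ)) (q + 1) r (by omega) (by omega) i
  simp only [map_add, map_natCast, map_one] at this
  rw [relU_monomial, relU_monomial, smul_add, this, pd_smul_hol_smul,
    pd_smul_yClass x (by omega) (by omega), pderivEnd_algebraMap, zero_smul, add_zero, add_assoc,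
    ← add_smul]
  congr 2
  simp only [map_sub, map_add, map_one, map_natCast, Nat.cast_add, Nat.cast_one]
  ring

theorem mkQ_one : (idealA x).mkQ 1 = yClass x 0 0 := by
  have := yClass_len_wt x 0
  rw [show len (0 : Fin k → ℕ) = 0 by simp [len], show wt (0 : Fin k → ℕ) = 0 by simp [wt],
    pdPow_zero] at this
  exact this.symm

theorem mkQ_eq_smul (P : DOp x) : (idealA x).mkQ P = P • yClass x 0 0 := by
  rw [← mkQ_one, ← map_smul, smul_eq_mul, mul_one]

theorem pd_smul_yClass_zero (i : Fin k) : pd x i • yClass x 0 0 = yClass x 1 ((i : ℕ) + 1) := by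
  rw [pd_smul_yClass x le_rfl (by omega) i, zero_add, zero_add]

theorem opE_smul : opE x • yClass x 0 0 =
    ∑ h : Fin k, coord x h • yClass x 1 ((h : ℕ) + 1) := by
  rw [opE, Finset.sum_smul]
  refine Finset.sum_congr rfl fun h _ => ?_
  rw [mul_smul, pd_smul_yClass_zero, sg, ofHol_smul]

/-- Moving the derivative past E produces one more copy of it, hence the coefficient 1+μ; the term
∂_1∂_{m+1} supplies the summand with σ_0 = 1. -/
theorem mkQ_opT (m : ℕ) (hm : m + 1 < k) :
    (idealA x).mkQ (opT x μ m hm) = relT x μ 1 (monomial (m + 2) 1) := by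
  have := pd_smul_sum_coord x (fun _ => 1) 1 0 (by omega) (by omega) ⟨m + 1, hm⟩
  simp only [map_one, one_mul, one_smul, zero_add] at this
  rw [mkQ_eq_smul, opT, add_smul, mul_smul, mul_smul, add_smul, pd_smul_yClass_zero,
    pd_smul_yClass x (by simp) (by simp only; omega), ← ofHol_algebraMap, ofHol_smul, opE_smul,
    smul_add, this, pd_smul_hol_smul, pd_smul_yClass_zero, pderivEnd_algebraMap, relT_monomial,
    Nat.cast_one, map_add, map_one]
  simp only [zero_add, zero_smul, add_zero, add_smul, one_smul, add_assoc, Nat.reduceAdd]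

theorem mkQ_opU0 : (idealA x).mkQ (opU0 x - algebraMap ℂ (DOp x) lam) =
    relU x lam 0 (monomial 0 1) := by
  rw [mkQ_eq_smul, sub_smul, ← ofHol_algebraMap, ofHol_smul, relU_monomial, Nat.cast_zero, zero_sub,
    map_neg, neg_smul, ← sub_eq_add_neg, opU0, Finset.sum_smul]
  congr 1
  refine Finset.sum_congr rfl fun h _ => ?_
  rw [mul_smul, mul_smul, pd_smul_yClass_zero, sg, ofHol_smul, ← map_natCast (ofHol x), ofHol_smul,
    smul_smul]
  simp

/-! ### The kernel of W → N as an O-span -/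

theorem pd_smul_mem_relSpan (i : Fin k) :
    ∀ m ∈ relSpan x μ lam, pd x i • m ∈ relSpan x μ lam := by
  refine pd_smul_mem_span ?_ i
  have hk : ∀ q, k * (q + 1) = k * q + k := fun q => Nat.mul_succ _ _
  rintro i _ (⟨q, r, h1, h2, rfl⟩ | ⟨q, r, h1, h2, rfl⟩)
  · rw [pd_smul_relT x μ h1 h2]
    have := hk q
    exact Submodule.subset_span (Or.inl ⟨q + 1, _, by omega, by omega, rfl⟩)
  · rw [pd_smul_relU x lam h1 h2]
    have := hk q
    exact Submodule.subset_span (Or.inr ⟨q + 1, _, by omega, by omega, rfl⟩)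

theorem mkQ_mem_relSpan {P : DOp x} (hP : P ∈ idealJ x μ lam) :
    (idealA x).mkQ P ∈ relSpan x μ lam := by
  -- Being ∂-stable, the O-span is a D-submodule, so only generators of J need testing.
  let K : Submodule (DOp x) (WStalk x) :=
    { (relSpan x μ lam).toAddSubmonoid with
      smul_mem' := fun P m hm => dop_smul_mem _ (pd_smul_mem_relSpan x μ lam) P m hm }
  have hK : ∀ w, w ∈ K ↔ w ∈ relSpan x μ lam := fun _ => Iff.rfl
  rw [← hK, ← Submodule.mem_comap]
  refine (show idealJ x μ lam ≤ _ from ?_) hP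
  refine sup_le (sup_le (fun P hP => ?_) (Submodule.span_le.2 ?_)) (Submodule.span_le.2 ?_)
  · rw [Submodule.mem_comap, Submodule.mkQ_apply, (Submodule.Quotient.mk_eq_zero _).2 hP]
    exact K.zero_mem
  · rintro _ ⟨m, hm, rfl⟩
    rw [SetLike.mem_coe, Submodule.mem_comap, mkQ_opT]
    exact Submodule.subset_span (Or.inl ⟨1, m + 2, by omega, by omega, rfl⟩)
  · rintro _ rfl
    rw [SetLike.mem_coe, Submodule.mem_comap, mkQ_opU0]
    exact Submodule.subset_span (Or.inr ⟨0, 0, by omega, by omega, rfl⟩)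

/-- The interval [a+1, b+k] is the sumset of [a, b] and [1, k]; thus relations of one degree are
derivatives of relations of the previous degree. -/
theorem exists_index_sub {k a b r : ℕ} (hk : 0 < k) (h1 : a + 1 ≤ r) (h2 : r ≤ b + k)
    (hab : a ≤ b) : ∃ (i : Fin k) (r' : ℕ), r = r' + ((i : ℕ) + 1) ∧ a ≤ r' ∧ r' ≤ b := by
  by_cases h : k ≤ r - a
  · exact ⟨⟨k - 1, by omega⟩, r - k, by simp only; omega, by omega, by omega⟩
  · exact ⟨⟨r - a - 1, by omega⟩, a, by simp only; omega, le_rfl, hab⟩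

theorem relT_mem_map (hk : 0 < k) (q r : ℕ) (h1 : q + 1 ≤ r) (h2 : r ≤ k * q) :
    relT x μ q (monomial r 1) ∈ (idealJ x μ lam).map (idealA x).mkQ := by
  induction q generalizing r with
  | zero => omega
  | succ q ih =>
    rcases Nat.eq_zero_or_pos q with rfl | hq
    · obtain ⟨m, rfl⟩ : ∃ m, r = m + 2 := ⟨r - 2, by omega⟩
      refine ⟨opT x μ m (by omega), ?_, mkQ_opT x μ m _⟩
      exact Submodule.mem_sup_left (Submodule.mem_sup_right
        (Submodule.subset_span ⟨m, by omega, rfl⟩))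
    · have hk2 : 2 ≤ k := by
        by_contra h
        obtain rfl : k = 1 := by omega
        omega
      have := Nat.mul_le_mul_right q hk2
      obtain ⟨i, r', rfl, h3, h4⟩ := exists_index_sub (a := q + 1) (b := k * q) hk h1
        (by rwa [Nat.mul_succ] at h2) (by omega)
      rw [← pd_smul_relT x μ h3 h4]
      exact Submodule.smul_mem _ _ (ih r' h3 h4)

theorem relU_mem_map (hk : 0 < k) (q r : ℕ) (h1 : q ≤ r) (h2 : r ≤ k * q) :
    relU x lam q (monomial r 1) ∈ (idealJ x μ lam).map (idealA x).mkQ := by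
  induction q generalizing r with
  | zero =>
    obtain rfl : r = 0 := by omega
    refine ⟨_, ?_, mkQ_opU0 x lam⟩
    exact Submodule.mem_sup_right (Submodule.subset_span rfl)
  | succ q ih =>
    obtain ⟨i, r', rfl, h3, h4⟩ := exists_index_sub (a := q) (b := k * q) hk h1
      (by rwa [Nat.mul_succ] at h2) (Nat.le_mul_of_pos_left _ hk)
    rw [← pd_smul_relU x lam h3 h4]
    exact Submodule.smul_mem _ _ (ih r' h3 h4)

theorem quotStalk_mkQ (P : DOp x) :
    quotStalk μ lam x ((idealA x).mkQ P) = (idealJ x μ lam).mkQ P := rfl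

/-- The kernel of the quotient map `W → N_{μ,λ}` is generated over `O_N` by the relations. -/
theorem quotStalk_eq_zero_iff (hk : 0 < k) (w : WStalk x) :
    quotStalk μ lam x w = 0 ↔ w ∈ relSpan x μ lam := by
  constructor
  · obtain ⟨P, rfl⟩ := (idealA x).mkQ_surjective w
    rw [quotStalk_mkQ, Submodule.mkQ_apply, Submodule.Quotient.mk_eq_zero]
    exact mkQ_mem_relSpan x μ lam
  · intro hw
    have key : ∀ v ∈ (idealJ x μ lam).map (idealA x).mkQ, quotStalk μ lam x v = 0 := by
      rintro _ ⟨P, hP, rfl⟩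
      rw [quotStalk_mkQ, Submodule.mkQ_apply, Submodule.Quotient.mk_eq_zero]
      exact hP
    induction hw using Submodule.span_induction with
    | mem v hv =>
      rcases hv with ⟨q, r, h1, h2, rfl⟩ | ⟨q, r, h1, h2, rfl⟩
      · exact key _ (relT_mem_map x μ lam hk q r h1 h2)
      · exact key _ (relU_mem_map x μ lam hk q r h1 h2)
    | zero => exact map_zero _
    | add a b _ _ ha hb => rw [map_add, ha, hb, add_zero]
    | smul f v _ hv => rw [quotStalk_smul, hv, smul_zero]

end Stalk

section Filtration

open Polynomial

variable {k : ℕ} (x : Pt k) (μ lam : ℂ)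

/-! ### The relations of bounded degree -/

/-- The relations involving only the generators `y_{q,r}` with `q ≤ Q`. -/
def relLe : ℕ → Submodule (HolGerm x) (WStalk x)
  | 0 => ⊥
  | Q + 1 => relLe Q ⊔ ((psupp (HolGerm x) (Q + 1) (k * Q)).map (relT x μ Q) ⊔
      (psupp (HolGerm x) Q (k * Q)).map (relU x lam Q))

/-- The relations coming from `U_0 - λ` involving only the generators `y_{q,r}` with `q ≤ Q`. -/
def relULe : ℕ → Submodule (HolGerm x) (WStalk x)
  | 0 => ⊥
  | Q + 1 => relULe Q ⊔ (psupp (HolGerm x) Q (k * Q)).map (relU x lam Q)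

theorem relLe_mono : Monotone (relLe x μ lam) := monotone_nat_of_le_succ fun _ => le_sup_left

theorem relULe_mono : Monotone (relULe x lam) := monotone_nat_of_le_succ fun _ => le_sup_left

theorem relT_mem_relLe {Q : ℕ} {a : (HolGerm x)[X]} (ha : a ∈ psupp (HolGerm x) (Q + 1) (k * Q)) :
    relT x μ Q a ∈ relLe x μ lam (Q + 1) :=
  Submodule.mem_sup_right (Submodule.mem_sup_left (Submodule.mem_map_of_mem ha))

theorem relU_mem_relLe {Q : ℕ} {b : (HolGerm x)[X]} (hb : b ∈ psupp (HolGerm x) Q (k * Q)) :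
    relU x lam Q b ∈ relLe x μ lam (Q + 1) :=
  Submodule.mem_sup_right (Submodule.mem_sup_right (Submodule.mem_map_of_mem hb))

theorem relU_mem_relULe {Q : ℕ} {b : (HolGerm x)[X]} (hb : b ∈ psupp (HolGerm x) Q (k * Q)) :
    relU x lam Q b ∈ relULe x lam (Q + 1) :=
  Submodule.mem_sup_right (Submodule.mem_map_of_mem hb)

theorem exists_mem_relLe {w : WStalk x} (hw : w ∈ relSpan x μ lam) : ∃ Q, w ∈ relLe x μ lam Q := by
  induction hw using Submodule.span_induction with
  | mem v hv =>
    rcases hv with ⟨q, r, h1, h2, rfl⟩ | ⟨q, r, h1, h2, rfl⟩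
    · exact ⟨q + 1, relT_mem_relLe x μ lam (monomial_mem_psupp _ h1 h2)⟩
    · exact ⟨q + 1, relU_mem_relLe x μ lam (monomial_mem_psupp _ h1 h2)⟩
  | zero => exact ⟨0, Submodule.zero_mem _⟩
  | add a b _ _ ha hb =>
    obtain ⟨Q, hQ⟩ := ha
    obtain ⟨Q', hQ'⟩ := hb
    exact ⟨max Q Q', Submodule.add_mem _ (relLe_mono x μ lam (le_max_left _ _) hQ)
      (relLe_mono x μ lam (le_max_right _ _) hQ')⟩
  | smul f v _ hv =>
    obtain ⟨Q, hQ⟩ := hv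
    exact ⟨Q, Submodule.smul_mem _ f hQ⟩

theorem sigPoly_mem_psupp : sigPoly x ∈ psupp (HolGerm x) 0 k := unitPoly_mem_psupp _

theorem sigPoly'_mem_psupp : sigPoly' x ∈ psupp (HolGerm x) 1 k :=
  X_mul_derivative_unitPoly_mem_psupp _

theorem mul_sigPoly_mem {m n : ℕ} {a : (HolGerm x)[X]} (ha : a ∈ psupp (HolGerm x) m (k * n)) :
    a * sigPoly x ∈ psupp (HolGerm x) m (k * (n + 1)) :=
  mul_mem_psupp ha (sigPoly_mem_psupp x)

theorem mul_sigPoly'_mem {m n : ℕ} {a : (HolGerm x)[X]} (ha : a ∈ psupp (HolGerm x) m (k * n)) :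
    a * sigPoly' x ∈ psupp (HolGerm x) (m + 1) (k * (n + 1)) :=
  mul_mem_psupp ha (sigPoly'_mem_psupp x)

theorem yCoeff_relT (p : ℕ) {q : ℕ} {a : (HolGerm x)[X]}
    (ha : a ∈ psupp (HolGerm x) (q + 1) (k * q)) :
    yCoeff x p (relT x μ q a) = (if q + 1 = p then a * sigPoly x else 0) +
      algebraMap ℂ (HolGerm x) (q + μ) • if q = p then a else 0 := by
  rw [relT_apply, map_add, map_smul, yCoeff_yPoly x p (mul_sigPoly_mem x ha),
    yCoeff_yPoly x p (psupp_mono (Nat.le_succ _) le_rfl ha)]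

theorem yCoeff_relU (p : ℕ) {q : ℕ} {b : (HolGerm x)[X]}
    (hb : b ∈ psupp (HolGerm x) q (k * q)) :
    yCoeff x p (relU x lam q b) = (if q + 1 = p then b * sigPoly' x else 0) +
      if q = p then eulerLam x lam b else 0 := by
  rw [relU_apply, map_add, yCoeff_yPoly x p (mul_sigPoly'_mem x hb),
    yCoeff_yPoly x p (eulerSub_mem_psupp hb)]

theorem relTheta_arg_mem {q : ℕ} {c : (HolGerm x)[X]}
    (hc : c ∈ psupp (HolGerm x) (q + 1) (k * q)) :
    eulerLam x lam c * sigPoly x - algebraMap ℂ (HolGerm x) (q + μ) • (c * sigPoly' x) ∈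
      psupp (HolGerm x) (q + 1) (k * (q + 1)) :=
  Submodule.sub_mem _ (mul_sigPoly_mem x (eulerSub_mem_psupp hc))
    (Submodule.smul_mem _ _ (psupp_mono (Nat.le_succ _) le_rfl (mul_sigPoly'_mem x hc)))

theorem yCoeff_eq_zero_of_mem_relLe {p Q : ℕ} (hp : Q < p) {w : WStalk x}
    (hw : w ∈ relLe x μ lam Q) : yCoeff x p w = 0 := by
  induction Q generalizing w with
  | zero => rw [(Submodule.mem_bot _).1 hw, map_zero]
  | succ Q ih =>
    obtain ⟨u, hu, v, hv, rfl⟩ := Submodule.mem_sup.1 hw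
    obtain ⟨_, ⟨a, ha, rfl⟩, _, ⟨b, hb, rfl⟩, rfl⟩ := Submodule.mem_sup.1 hv
    rw [map_add, map_add, ih (by omega) hu, yCoeff_relT x μ p ha, yCoeff_relU x lam p hb,
      if_neg (by omega), if_neg (by omega), if_neg (by omega), if_neg (by omega)]
    simp

/-- A relation whose component of top degree vanishes is a relation of smaller degree. -/
theorem mem_relLe_of_yCoeff_eq_zero (hk : 0 < k) {Q : ℕ} {w : WStalk x}
    (hw : w ∈ relLe x μ lam (Q + 2)) (h : yCoeff x (Q + 2) w = 0) : w ∈ relLe x μ lam (Q + 1) := by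
  obtain ⟨u, hu, v, hv, rfl⟩ := Submodule.mem_sup.1 hw
  obtain ⟨_, ⟨a, ha, rfl⟩, _, ⟨b, hb, rfl⟩, rfl⟩ := Submodule.mem_sup.1 hv
  rw [map_add, map_add, yCoeff_eq_zero_of_mem_relLe x μ lam (by omega) hu, yCoeff_relT x μ _ ha,
    yCoeff_relU x lam _ hb, if_pos rfl, if_pos rfl, if_neg (by omega), if_neg (by omega), smul_zero,
    add_zero, add_zero, zero_add] at h
  obtain ⟨c, rfl, rfl⟩ := sigPoly_syzygy hk x h
  -- The support of c is read off from that of b = −cR.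
  have hc : c ∈ psupp (HolGerm x) (Q + 1) (k * Q) := by
    refine mem_psupp_of_mul_mem (coeff_zero_unitPoly _) (natDegree_unitPoly hk _ (coord_ne_zero x _))
      (R := sigPoly x) ?_
    have h1 := Submodule.neg_mem _ hb
    rw [neg_neg] at h1
    exact h1
  refine Submodule.add_mem _ hu ?_
  -- The top components cancel. In degree Q+1 there remains (Q+1+μ)cR' − D(cR), and D(cR) = Dc·R +
  -- cR'.
  have key : relT x μ (Q + 1) (c * (X * derivative (sigPoly x))) +
      relU x lam (Q + 1) (-(c * sigPoly x)) = -relTheta x μ lam Q c := by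
    have h1 : c * (X * derivative (sigPoly x)) * sigPoly x + -(c * sigPoly x) * sigPoly' x = 0 := by
      rw [sigPoly']; ring
    rw [relT_apply, relU_apply, relTheta_apply, add_add_add_comm, ← map_add, h1, map_zero, zero_add,
      ← map_smul, ← map_add, ← map_neg]
    congr 1
    rw [eulerLam, map_neg, eulerSub_mul, ← sigPoly', Nat.cast_succ, add_right_comm,
      map_add _ _ (1 : ℂ), map_one, add_smul, one_smul]
    ring
  rw [key, relTheta_eq]
  exact Submodule.neg_mem _ (Submodule.sub_mem _ (relT_mem_relLe x μ lam (eulerSub_mem_psupp hc))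
    (Submodule.smul_mem _ _ (relU_mem_relLe x μ lam (psupp_mono (Nat.le_succ _) le_rfl hc))))

theorem mem_relLe_of_forall_yCoeff (hk : 0 < k) {n Q : ℕ} {w : WStalk x}
    (hw : w ∈ relLe x μ lam Q) (h : ∀ p, n + 1 < p → yCoeff x p w = 0) :
    w ∈ relLe x μ lam (n + 1) := by
  induction Q with
  | zero => exact relLe_mono x μ lam (Nat.zero_le _) hw
  | succ Q ih =>
    by_cases hQ : Q ≤ n
    · exact relLe_mono x μ lam (by omega) hw
    · obtain ⟨Q, rfl⟩ : ∃ m, Q = m + 1 := ⟨Q - 1, by omega⟩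
      exact ih (mem_relLe_of_yCoeff_eq_zero x μ lam hk hw (h _ (by omega)))

/-! ### Using that λ avoids the integers of [0, kn] -/

theorem isUnit_natCast_sub {i : ℕ} (h : lam ≠ i) :
    IsUnit ((i : HolGerm x) - algebraMap ℂ (HolGerm x) lam) := by
  rw [← map_natCast (algebraMap ℂ (HolGerm x)), ← map_sub]
  exact (sub_ne_zero.2 h.symm).isUnit.map _

theorem exists_relU_sum {Q : ℕ} {w : WStalk x} (hw : w ∈ relULe x lam Q) :
    ∃ b : ℕ → (HolGerm x)[X], (∀ q, b q ∈ psupp (HolGerm x) q (k * q)) ∧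
      w = ∑ q ∈ Finset.range Q, relU x lam q (b q) := by
  induction Q generalizing w with
  | zero => exact ⟨0, fun q => Submodule.zero_mem _, by simpa using (Submodule.mem_bot _).1 hw⟩
  | succ Q ih =>
    obtain ⟨u, hu, _, ⟨b, hb, rfl⟩, rfl⟩ := Submodule.mem_sup.1 hw
    obtain ⟨b', hb', rfl⟩ := ih hu
    refine ⟨Function.update b' Q b, fun q => ?_, ?_⟩
    · by_cases h : q = Q
      · subst h; rwa [Function.update_self]
      · rw [Function.update_of_ne h]; exact hb' q
    · rw [Finset.sum_range_succ, Function.update_self]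
      refine congrArg (· + relU x lam Q b) (Finset.sum_congr rfl fun q hq => ?_)
      rw [Function.update_of_ne (Finset.mem_range.1 hq).ne]

/-- The component of degree q of ∑ `relU` b_q is Db_q + b_{q−1}R'. Going up from q = 0, injectivity
of D kills the b_q one after another. -/
theorem eq_zero_of_mem_relULe {n : ℕ} (hlam : ∀ i : ℕ, i ≤ k * n → lam ≠ i) {w : WStalk x}
    (hw : w ∈ relULe x lam (n + 1)) (h : ∀ p, p ≤ n → yCoeff x p w = 0) : w = 0 := by
  obtain ⟨b, hb, rfl⟩ := exists_relU_sum x lam hw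
  have hb0 : ∀ q, q ≤ n → b q = 0 := by
    intro q
    induction q using Nat.strong_induction_on with
    | _ q ih =>
      intro hq
      have h1 := h q hq
      rw [map_sum, Finset.sum_eq_single q] at h1
      · rw [yCoeff_relU x lam q (hb q), if_neg (by omega), if_pos rfl, zero_add] at h1
        have hne : ∀ i : ℕ, q ≤ i → i ≤ k * q →
            algebraMap ℂ (HolGerm x) lam ≠ (i : HolGerm x) := fun i _ hi =>
          (sub_ne_zero.1 (isUnit_natCast_sub x lam
            (hlam i (hi.trans (Nat.mul_le_mul_left k hq)))).ne_zero).symm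
        exact eq_zero_of_eulerSub hne (hb q) h1
      · intro p _ hp
        by_cases hpq : p < q
        · rw [ih p hpq (by omega), map_zero, map_zero]
        · rw [yCoeff_relU x lam q (hb p), if_neg (by omega), if_neg hp, add_zero]
      · intro hq'
        exact absurd (Finset.mem_range.2 (by omega)) hq'
  refine Finset.sum_eq_zero fun q hq => ?_
  rw [hb0 q (by have := Finset.mem_range.1 hq; omega), map_zero]

/-- Choose e with De = cR' and put g = cR − (q+1+μ)e. Then Dg is the polynomial of θ(c), so modulo
the U-relation of g, θ(c) becomes −θ(e) one degree higher. Iterating reaches degree n+1. -/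
theorem relTheta_mem_sup {n : ℕ} (hlam : ∀ i : ℕ, i ≤ k * n → lam ≠ i) (d q : ℕ) (hq : q + d = n)
    {c : (HolGerm x)[X]} (hc : c ∈ psupp (HolGerm x) (q + 1) (k * q)) :
    relTheta x μ lam q c ∈ relULe x lam (n + 1) ⊔
      (psupp (HolGerm x) (n + 1) (k * n)).map (relTheta x μ lam n) := by
  induction d generalizing q c with
  | zero =>
    obtain rfl : q = n := hq
    exact Submodule.mem_sup_right (Submodule.mem_map_of_mem hc)
  | succ d ih =>
    have hcR := mul_sigPoly'_mem x hc
    obtain ⟨e, he, hce⟩ := exists_eulerSub_eq (fun i _ hi => isUnit_natCast_sub x lam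
      (hlam i (hi.trans (Nat.mul_le_mul_left k (by omega : q + 1 ≤ n))))) hcR
    let g := c * sigPoly x - algebraMap ℂ (HolGerm x) ((q + 1 : ℕ) + μ) • e
    have hg : g ∈ psupp (HolGerm x) (q + 1) (k * (q + 1)) :=
      Submodule.sub_mem _ (mul_sigPoly_mem x hc)
        (Submodule.smul_mem _ _ (psupp_mono (Nat.le_succ _) le_rfl he))
    have hDg : eulerLam x lam g = eulerLam x lam c * sigPoly x -
        algebraMap ℂ (HolGerm x) (q + μ) • (c * sigPoly' x) := by
      rw [map_sub, map_smul, hce, eulerLam, eulerSub_mul, ← sigPoly', Nat.cast_succ,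
        add_right_comm, map_add _ _ (1 : ℂ), map_one, add_smul, one_smul]
      ring
    have key : relTheta x μ lam q c = relU x lam (q + 1) g - relTheta x μ lam (q + 1) e := by
      rw [relU_apply, hDg, ← relTheta_apply, relTheta_apply x μ lam (q + 1), hce, add_sub_right_comm,
        ← map_sub]
      have : g * sigPoly' x - (c * sigPoly' x * sigPoly x -
          algebraMap ℂ (HolGerm x) ((q + 1 : ℕ) + μ) • (e * sigPoly' x)) = 0 := by
        simp only [g, smul_eq_C_mul]; ring
      rw [this, map_zero, zero_add]
    rw [key]
    exact Submodule.sub_mem _ (Submodule.mem_sup_left (relULe_mono x lam (by omega)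
      (relU_mem_relULe x lam hg))) (ih (q + 1) (by omega) he)

/-- Since D is onto, every T-relation is that of some Dc, which is θ(c) plus a multiple of the
U-relation of c. -/
theorem relLe_le_sup {n : ℕ} (hlam : ∀ i : ℕ, i ≤ k * n → lam ≠ i) (Q : ℕ) (hQ : Q ≤ n + 1) :
    relLe x μ lam Q ≤ relULe x lam (n + 1) ⊔
      (psupp (HolGerm x) (n + 1) (k * n)).map (relTheta x μ lam n) := by
  induction Q with
  | zero => exact bot_le
  | succ Q ih =>
    have hU : ∀ b ∈ psupp (HolGerm x) Q (k * Q), relU x lam Q b ∈ relULe x lam (n + 1) ⊔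
        (psupp (HolGerm x) (n + 1) (k * n)).map (relTheta x μ lam n) := fun b hb =>
      Submodule.mem_sup_left (relULe_mono x lam hQ (relU_mem_relULe x lam hb))
    refine sup_le (ih (by omega)) (sup_le ?_ ?_)
    · rintro _ ⟨a, ha, rfl⟩
      obtain ⟨c, hc, rfl⟩ := exists_eulerSub_eq (fun i _ hi => isUnit_natCast_sub x lam
        (hlam i (hi.trans (Nat.mul_le_mul_left k (by omega : Q ≤ n))))) ha
      have := relTheta_eq x μ lam Q c
      rw [eq_sub_iff_add_eq] at this
      rw [← this]
      exact Submodule.add_mem _ (relTheta_mem_sup x μ lam hlam (n - Q) Q (by omega) hc)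
        (Submodule.smul_mem _ _ (hU c (psupp_mono (Nat.le_succ _) le_rfl hc)))
    · rintro _ ⟨b, hb, rfl⟩
      exact hU b hb

/-- An element of `W_{n+1}` which is a relation is a combination of the `θ_{n+1,r}`. -/
theorem exists_eq_relTheta (hk : 0 < k) {n : ℕ} (hlam : ∀ i : ℕ, i ≤ k * n → lam ≠ i)
    {f : (HolGerm x)[X]} (hf : f ∈ psupp (HolGerm x) (n + 1) (k * (n + 1)))
    (h : yPoly x (n + 1) f ∈ relSpan x μ lam) :
    ∃ c ∈ psupp (HolGerm x) (n + 1) (k * n),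
      f = eulerLam x lam c * sigPoly x - algebraMap ℂ (HolGerm x) (n + μ) • (c * sigPoly' x) := by
  obtain ⟨Q, hQ⟩ := exists_mem_relLe x μ lam h
  have h1 := mem_relLe_of_forall_yCoeff x μ lam hk (n := n) hQ fun p hp => by
    rw [yCoeff_yPoly x p hf, if_neg (by omega)]
  obtain ⟨u, hu, _, ⟨c, hc, rfl⟩, hw⟩ :=
    Submodule.mem_sup.1 (relLe_le_sup x μ lam hlam (n + 1) le_rfl h1)
  -- Both the given element and θ(c) live in degree n+1, so u has no component in degrees ≤ n.
  have hu0 : u = 0 := by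
    refine eq_zero_of_mem_relULe x lam hlam hu fun p hp => ?_
    rw [eq_sub_of_add_eq hw, relTheta_apply, map_sub, yCoeff_yPoly x p hf,
      yCoeff_yPoly x p (relTheta_arg_mem x μ lam hc), if_neg (by omega), if_neg (by omega), sub_zero]
  refine ⟨c, hc, ?_⟩
  rw [hu0, zero_add, relTheta_apply] at hw
  have := congrArg (yCoeff x (n + 1)) hw
  rw [yCoeff_yPoly x _ hf, yCoeff_yPoly x _ (relTheta_arg_mem x μ lam hc), if_pos rfl,
    if_pos rfl] at this
  exact this.symm

end Filtration

/-! ### Bases of sheaves generated by global sections -/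

/-- The value at `x` of a germ at `x`. -/
def germVal {k : ℕ} {x : Pt k} (g : HolGerm x) : ℂ := Germ.value g.1

theorem germVal_germAt {k : ℕ} {x : Pt k} (f : Pt k → ℂ) (hf : AnalyticAt ℂ f x) :
    germVal (germAt x f hf) = f x := rfl

theorem mem_HolSec_of_locally {k : ℕ} {U : Opens (Pt k)} (f : ∀ x : U, HolGerm (x : Pt k))
    (h : ∀ x : U, ∃ (V : Opens (Pt k)) (hV : V ≤ U), (x : Pt k) ∈ V ∧
      ∃ c : HolSec V, ∀ y : V, c.1 y = f ⟨y, hV y.2⟩) : f ∈ HolSec U := by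
  classical
  -- The function is recovered from the values of its germs; its values off U are irrelevant.
  let φ : Pt k → ℂ := fun y => if hy : y ∈ U then germVal (f ⟨y, hy⟩) else 0
  have key : ∀ x : U, ∃ hx : AnalyticAt ℂ φ x, f x = germAt (x : Pt k) φ hx := by
    intro x
    obtain ⟨V, hV, hxV, ⟨c, ψ, hψ, hc⟩, hcf⟩ := h x
    have heq : φ =ᶠ[𝓝 (x : Pt k)] ψ := by
      filter_upwards [V.isOpen.mem_nhds hxV] with y hy
      have h1 := (hcf ⟨y, hy⟩).symm.trans (hc ⟨y, hy⟩)
      simp only [φ, dif_pos (hV hy), h1, germVal_germAt]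
    have h1 := (hcf ⟨x, hxV⟩).symm.trans (hc ⟨x, hxV⟩)
    refine ⟨(hψ ⟨x, hxV⟩).congr heq.symm, h1.trans ?_⟩
    exact (germAt_eq_iff _ _).2 heq.symm
  exact ⟨φ, fun x => (key x).1, fun x => (key x).2⟩

section Basis

variable {k : ℕ} {F : Pt k → Type} [∀ x, AddCommGroup (F x)] [∀ x, Module (HolGerm x) (F x)]

/-- The germ at a point of a family of germs. -/
def famEval {U : Opens (Pt k)} (x : U) : Fam F U →+ F (x : Pt k) where
  toFun s := s x
  map_zero' := rfl
  map_add' _ _ := rfl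

theorem famEval_sum_smul {ι : Type*} (t : Finset ι) {U : Opens (Pt k)} (c : ι → HolSec U)
    (g : ι → Fam F U) (x : U) :
    famEval x (∑ i ∈ t, c i • g i) = ∑ i ∈ t, (c i).1 x • g i x := by
  rw [map_sum]
  rfl

theorem combSec_le_genSheaf (G : Set (∀ x : Pt k, F x)) (U : Opens (Pt k)) :
    combSec G U ≤ genSheaf G U := fun _ hs x => ⟨U, le_rfl, x.2, hs⟩

theorem fam_linearIndependent {ι : Type*} [Fintype ι] {g : ι → ∀ x : Pt k, F x} (U : Opens (Pt k))
    (hli : ∀ x, LinearIndependent (HolGerm x) fun i => g i x) {v : ι → Fam F U}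
    (hv : ∀ i, v i = glob U (g i)) : LinearIndependent (HolSec U) v := by
  obtain rfl : v = fun i => glob U (g i) := funext hv
  rw [Fintype.linearIndependent_iff]
  intro c hc i
  refine Subtype.ext (funext fun x => ?_)
  have h2 := famEval_sum_smul Finset.univ c (fun i => glob U (g i)) x
  rw [hc, map_zero] at h2
  exact Fintype.linearIndependent_iff.1 (hli x) (fun i => (c i).1 x) h2.symm i

/-- Independence at each stalk makes local coefficients unique, so they glue over any U. -/
theorem exists_basis_genSheaf {ι : Type*} [Fintype ι] (G : Set (∀ x : Pt k, F x))
    (g : ι → ∀ x : Pt k, F x)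
    (hspan : ∀ V : Opens (Pt k),
      combSec G V = Submodule.span (HolSec V) (Set.range fun i => glob V (g i)))
    (hli : ∀ x, LinearIndependent (HolGerm x) fun i => g i x) (U : Opens (Pt k)) :
    ∃ b : Module.Basis ι (HolSec U) (genSheaf G U), ∀ i, (b i : Fam F U) = glob U (g i) := by
  have hmem : ∀ i, glob U (g i) ∈ genSheaf G U := fun i =>
    combSec_le_genSheaf G U (by rw [hspan]; exact Submodule.subset_span ⟨i, rfl⟩)
  let v : ι → genSheaf G U := fun i => ⟨glob U (g i), hmem i⟩
  have hLI : LinearIndependent (HolSec U) v :=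
    LinearIndependent.of_comp (genSheaf G U).subtype (fam_linearIndependent U hli fun _ => rfl)
  have hSp : ⊤ ≤ Submodule.span (HolSec U) (Set.range v) := by
    rintro ⟨s, hs⟩ -
    have hloc : ∀ x : U, ∃ (V : Opens (Pt k)) (hV : V ≤ U) (c : ι → HolSec V), (x : Pt k) ∈ V ∧
        ∀ y : V, s ⟨y, hV y.2⟩ = ∑ i, (c i).1 y • g i y := by
      intro x
      obtain ⟨V, hV, hxV, h⟩ := hs x
      rw [hspan, Submodule.mem_span_range_iff_exists_fun] at h
      obtain ⟨c, hc⟩ := h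
      refine ⟨V, hV, c, hxV, fun y => ?_⟩
      have h2 := famEval_sum_smul Finset.univ c (fun i => glob V (g i)) y
      rw [hc] at h2
      exact h2
    choose V hV c hxV hc using hloc
    -- The germ at x is taken from the neighbourhood chosen for x; uniqueness identifies it with the
    -- coefficients chosen for other points.
    let f : ι → ∀ x : U, HolGerm (x : Pt k) := fun i x => (c x i).1 ⟨x, hxV x⟩
    have hf : ∀ x : U, s x = ∑ i, f i x • g i x := fun x => hc x ⟨x, hxV x⟩
    have hfsec : ∀ i, f i ∈ HolSec U := by
      intro i
      refine mem_HolSec_of_locally _ fun x => ⟨V x, hV x, hxV x, c x i, fun y => ?_⟩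
      have h1 := (hc x y).symm.trans (hf ⟨y, hV x y.2⟩)
      rw [← sub_eq_zero, ← Finset.sum_sub_distrib] at h1
      simp only [← sub_smul] at h1
      exact sub_eq_zero.1 (Fintype.linearIndependent_iff.1 (hli y)
        (fun i => (c x i).1 y - f i ⟨y, hV x y.2⟩) h1 i)
    rw [Submodule.mem_span_range_iff_exists_fun]
    refine ⟨fun i => ⟨f i, hfsec i⟩, Subtype.ext ?_⟩
    change (genSheaf G U).subtype _ = s
    rw [map_sum]
    funext x
    refine (famEval_sum_smul Finset.univ (fun i => ⟨f i, hfsec i⟩) (fun i => glob U (g i)) x).trans ?_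
    exact (hf x).symm
  exact ⟨Module.Basis.mk hLI hSp, fun i => by rw [Module.Basis.mk_apply]⟩

/-- The holomorphic function `a σ_{h+1}`. -/
def coordSec (U : Opens (Pt k)) (a : ℂ) (h : Fin k) : HolSec U :=
  ⟨fun x => algebraMap ℂ _ a * coord (x : Pt k) h, fun y => a * y h,
    fun x => analyticAt_const.mul (coord_analyticAt x h), fun x => by
      beta_reduce
      rw [algebraMap_eq_germAt, coord_eq_germAt, germAt_mul]; rfl⟩

/-- A constant function. -/
def constSec (U : Opens (Pt k)) (a : ℂ) : HolSec U :=
  ⟨fun _ => algebraMap ℂ _ a, fun _ => a, fun _ => analyticAt_const, fun x => algebraMap_eq_germAt (x : Pt k) a⟩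

theorem glob_affine (V : Opens (Pt k)) {a t : ∀ x : Pt k, F x} {b : Fin k → ∀ x : Pt k, F x}
    {c : ℂ} {d : Fin k → ℂ}
    (h : ∀ x, t x = algebraMap ℂ (HolGerm x) c • a x +
      ∑ i, (algebraMap ℂ (HolGerm x) (d i) * coord x i) • b i x) :
    glob V t = constSec V c • glob V a + ∑ i, coordSec V (d i) i • glob V (b i) := by
  funext x
  have h1 : famEval x (constSec V c • glob V a + ∑ i, coordSec V (d i) i • glob V (b i)) =
      algebraMap ℂ (HolGerm (x : Pt k)) c • a x +
        ∑ i, (algebraMap ℂ (HolGerm (x : Pt k)) (d i) * coord (x : Pt k) i) • b i x := by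
    rw [map_add, famEval_sum_smul]
    rfl
  exact (h x).trans h1.symm

/-- One step of triangular elimination: the leading coefficient is a nonzero constant, hence
invertible over every open set. -/
theorem glob_mem_of_affine {V : Opens (Pt k)} {K : Submodule (HolSec V) (Fam F V)}
    {a t : ∀ x : Pt k, F x} {b : Fin k → ∀ x : Pt k, F x} {c : ℂ} {d : Fin k → ℂ}
    (h : ∀ x, t x = algebraMap ℂ (HolGerm x) c • a x +
      ∑ i, (algebraMap ℂ (HolGerm x) (d i) * coord x i) • b i x) (hc : c ≠ 0)
    (ht : glob V t ∈ K) (hb : ∀ i, glob V (b i) ∈ K) : glob V a ∈ K := by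
  have h1 : constSec V c⁻¹ * constSec V c = 1 := by
    refine Subtype.ext (funext fun x => ?_)
    change algebraMap ℂ (HolGerm (x : Pt k)) c⁻¹ * algebraMap ℂ _ c = 1
    rw [← map_mul, inv_mul_cancel₀ hc, map_one]
  have h2 : glob V a = constSec V c⁻¹ •
      (glob V t - ∑ i, coordSec V (d i) i • glob V (b i)) := by
    rw [glob_affine V h, add_sub_cancel_right, ← mul_smul, h1, one_smul]
  rw [h2]
  exact K.smul_mem _ (K.sub_mem ht (K.sum_mem fun i _ => K.smul_mem _ (hb i)))

end Basis

section Main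

open Polynomial

variable {k : ℕ} (μ lam : ℂ)

theorem exists_basis_ker {R M M' ι κ : Type*} [CommRing R] [AddCommGroup M] [AddCommGroup M']
    [Module R M] [Module R M'] [Fintype ι] [Fintype κ] (B : Module.Basis (ι ⊕ κ) R M)
    (L : M →ₗ[R] M') (h0 : ∀ i, L (B (Sum.inl i)) = 0)
    (hli : LinearIndependent R fun j => L (B (Sum.inr j))) :
    ∃ b : Module.Basis ι R (LinearMap.ker L), ∀ i, (b i : M) = B (Sum.inl i) := by
  let v : ι → LinearMap.ker L := fun i => ⟨B (Sum.inl i), h0 i⟩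
  have hLI : LinearIndependent R v := by
    refine LinearIndependent.of_comp (LinearMap.ker L).subtype ?_
    exact B.linearIndependent.comp Sum.inl Sum.inl_injective
  have hSp : ⊤ ≤ Submodule.span R (Set.range v) := by
    rintro ⟨s, hs⟩ -
    have hsum := B.sum_repr s
    rw [Fintype.sum_sum_type] at hsum
    have hr : ∀ j, B.repr s (Sum.inr j) = 0 := by
      refine Fintype.linearIndependent_iff.1 hli _ ?_
      have h1 := LinearMap.mem_ker.1 hs
      rw [← hsum, map_add, map_sum, map_sum] at h1
      simpa only [map_smul, h0, smul_zero, Finset.sum_const_zero, zero_add] using h1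
    rw [Submodule.mem_span_range_iff_exists_fun]
    refine ⟨fun i => B.repr s (Sum.inl i), Subtype.ext ?_⟩
    simp only [hr, zero_smul, Finset.sum_const_zero, add_zero] at hsum
    simpa [v] using hsum
  exact ⟨Module.Basis.mk hLI hSp, fun i => by rw [Module.Basis.mk_apply]⟩

/-! ### Independence statements on stalks -/

/-- R has constant term 1 and R' has none, so if c starts at t^i the coefficient of t^i in θ(c) is
(i−λ)c_i. -/
theorem eq_zero_of_relTheta_arg (x : Pt k) {n : ℕ} (hlam : ∀ i : ℕ, i ≤ k * n → lam ≠ i)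
    {m : ℕ} {c : (HolGerm x)[X]} (hc : c ∈ psupp (HolGerm x) m (k * n))
    (h : ∀ i, i ≤ k * n → (eulerLam x lam c * sigPoly x -
      algebraMap ℂ (HolGerm x) (n + μ) • (c * sigPoly' x)).coeff i = 0) : c = 0 := by
  ext i
  rw [coeff_zero]
  induction i using Nat.strong_induction_on with
  | _ i ih =>
    by_cases hi : i ≤ k * n
    · have h1 : ∀ R : (HolGerm x)[X], (c * R).coeff i = c.coeff i * R.coeff 0 := by
        intro R
        rw [coeff_mul, Finset.sum_eq_single (i, 0)]
        · rintro ⟨a, b⟩ hab hne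
          have hab : a + b = i := Finset.HasAntidiagonal.mem_antidiagonal.1 hab
          have : a ≠ i := by
            rintro rfl
            exact hne (Prod.ext rfl (by simp only; omega))
          rw [ih a (by omega), zero_mul]
        · exact fun h => absurd (Finset.HasAntidiagonal.mem_antidiagonal.2 (add_zero i)) h
      have h2 : (eulerLam x lam c * sigPoly x).coeff i = (eulerLam x lam c).coeff i := by
        have := eq_sub_of_add_eq (eulerSub_mul (algebraMap ℂ (HolGerm x) lam) c (sigPoly x)).symm
        rw [eulerLam, this, coeff_sub, coeff_eulerSub, coeff_eulerSub, h1, h1]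
        simp [sigPoly, coeff_zero_unitPoly]
      have h3 := h i hi
      rw [coeff_sub, coeff_smul, h1, h2, coeff_eulerSub] at h3
      simp only [sigPoly', mul_coeff_zero, coeff_X_zero, zero_mul, mul_zero, smul_zero,
        sub_zero] at h3
      exact (mul_eq_zero.1 h3).resolve_left (isUnit_natCast_sub x lam (hlam i hi)).ne_zero
    · exact hc i (Or.inr (by omega))

/-- The index `r` of the `j`-th of the generators `y_{n+1,r}` with `r > kn`. -/
theorem top_index_le (hk : 0 < k) (n : ℕ) (j : Fin k) :
    n + 1 ≤ k * n + 1 + (j : ℕ) ∧ k * n + 1 + (j : ℕ) ≤ k * (n + 1) := by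
  have := Nat.le_mul_of_pos_left n hk
  have := j.2
  rw [Nat.mul_succ]
  omega

/-- A combination in the kernel is some θ(c) without exponents ≤ kn, and the lowest coefficient
forces c = 0. -/
theorem quotStalk_top_linearIndependent (hk : 0 < k) {n : ℕ}
    (hlam : ∀ i : ℕ, i ≤ k * n → lam ≠ i) (x : Pt k) :
    LinearIndependent (HolGerm x)
      fun j : Fin k => quotStalk μ lam x (yClass x (n + 1) (k * n + 1 + (j : ℕ))) := by
  rw [Fintype.linearIndependent_iff]
  intro g hg
  let f : (HolGerm x)[X] := ∑ j : Fin k, monomial (k * n + 1 + (j : ℕ)) (g j)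
  have hf : f ∈ psupp (HolGerm x) (n + 1) (k * (n + 1)) :=
    Submodule.sum_mem _ fun j _ =>
      monomial_mem_psupp _ (top_index_le hk n j).1 (top_index_le hk n j).2
  have hy : quotStalk μ lam x (yPoly x (n + 1) f) = 0 := by
    rw [← hg]
    simp only [f, map_sum, yPoly_monomial, quotStalk_smul]
  rw [quotStalk_eq_zero_iff x μ lam hk] at hy
  obtain ⟨c, hc, hfc⟩ := exists_eq_relTheta x μ lam hk hlam hf hy
  have hc0 : c = 0 := by
    refine eq_zero_of_relTheta_arg μ lam x hlam hc fun i hi => ?_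
    rw [← hfc]
    simp only [f, finsetSum_coeff]
    exact Finset.sum_eq_zero fun j _ => by rw [coeff_monomial, if_neg (by omega)]
  have hf0 : f = 0 := by rw [hfc, hc0]; simp
  intro j
  have := congrArg (fun p => coeff p (k * n + 1 + (j : ℕ))) hf0
  simp only [f, finsetSum_coeff, coeff_zero] at this
  rw [Finset.sum_eq_single j] at this
  · simpa using this
  · intro i _ hi
    rw [coeff_monomial, if_neg]
    exact fun h => hi (Fin.ext (by omega))
  · simp

theorem theta_linearIndependent {n : ℕ} (hlam : ∀ i : ℕ, i ≤ k * n → lam ≠ i) (x : Pt k) :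
    LinearIndependent (HolGerm x)
      fun r : Finset.Icc (n + 1) (k * n) => thetaStalk μ lam (n + 1) r x := by
  rw [Fintype.linearIndependent_iff]
  intro g hg
  let c : (HolGerm x)[X] := ∑ r : Finset.Icc (n + 1) (k * n), monomial (r : ℕ) (g r)
  have hc : c ∈ psupp (HolGerm x) (n + 1) (k * n) :=
    Submodule.sum_mem _ fun r _ =>
      monomial_mem_psupp _ (Finset.mem_Icc.1 r.2).1 (Finset.mem_Icc.1 r.2).2
  have hy : relTheta x μ lam n c = 0 := by
    rw [← hg, map_sum]
    refine Finset.sum_congr rfl fun r _ => ?_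
    rw [← relTheta_monomial, ← map_smul, smul_monomial, smul_eq_mul, mul_one]
  have h0 := congrArg (yCoeff x (n + 1)) hy
  rw [relTheta_apply, yCoeff_yPoly x _ (relTheta_arg_mem x μ lam hc), if_pos rfl, map_zero] at h0
  have hc0 : c = 0 := eq_zero_of_relTheta_arg μ lam x hlam hc fun i _ => by rw [h0, coeff_zero]
  intro r
  have := congrArg (fun p => coeff p (r : ℕ)) hc0
  simp only [c, finsetSum_coeff, coeff_zero] at this
  rw [Finset.sum_eq_single r] at this
  · simpa using this
  · intro i _ hi
    rw [coeff_monomial, if_neg]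
    exact fun h => hi (Subtype.ext h)
  · simp

theorem quotStalk_thetaStalk (hk : 0 < k) (x : Pt k) {n r : ℕ} (h1 : n + 1 ≤ r) (h2 : r ≤ k * n) :
    quotStalk μ lam x (thetaStalk μ lam (n + 1) r x) = 0 := by
  rw [quotStalk_eq_zero_iff x μ lam hk, ← relTheta_monomial, relTheta_eq, eulerSub_monomial, mul_one]
  have : monomial r ((r : HolGerm x) - algebraMap ℂ (HolGerm x) lam) =
      ((r : HolGerm x) - algebraMap ℂ (HolGerm x) lam) • monomial r (1 : HolGerm x) := by
    rw [smul_monomial, smul_eq_mul, mul_one]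
  rw [this, map_smul]
  exact Submodule.sub_mem _
    (Submodule.smul_mem _ _ (Submodule.subset_span (Or.inl ⟨n, r, h1, h2, rfl⟩)))
    (Submodule.smul_mem _ _ (Submodule.subset_span (Or.inr ⟨n, r, by omega, h2, rfl⟩)))

/-! ### The basis of `W_q` adapted to the kernel -/

/-- The global sections `θ_{n+1,r}`, for `r ∈ [n+1, kn]`, and `y_{n+1,r}`, for `r > kn`. -/
def adaptedSec (n : ℕ) : Finset.Icc (n + 1) (k * n) ⊕ Fin k → ∀ x : Pt k, WStalk x
  | Sum.inl r => thetaStalk μ lam (n + 1) r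
  | Sum.inr j => fun x => yClass x (n + 1) (k * n + 1 + (j : ℕ))

theorem glob_yClass_mem (n : ℕ) (V : Opens (Pt k)) (r : ℕ) :
    glob V (fun x => yClass x n r) ∈ combSec (genW k n) V := by
  by_cases h : n ≤ r ∧ r ≤ k * n
  · obtain ⟨α, rfl, rfl⟩ := exists_len_wt n r h.1 h.2
    exact Submodule.subset_span ⟨_, ⟨α, rfl, funext fun x => yClass_len_wt x α⟩, rfl⟩
  · have : glob V (fun x => yClass x n r) = (0 : Fam WStalk V) :=
      funext fun x => yClass_eq_zero (x : Pt k) h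
    rw [this]
    exact Submodule.zero_mem _

/-- Descending induction on r: θ_{n+1,r} has leading coefficient r−λ ≠ 0 on y_{n+1,r} and otherwise
involves larger r. -/
theorem combSec_genW {n : ℕ} (hlam : ∀ i : ℕ, i ≤ k * n → lam ≠ i)
    (V : Opens (Pt k)) : combSec (genW k (n + 1)) V =
      Submodule.span (HolSec V) (Set.range fun i => glob V (adaptedSec μ lam n i)) := by
  have haff : ∀ (r : ℕ) (x : Pt k), thetaStalk μ lam (n + 1) r x =
      algebraMap ℂ (HolGerm x) (r - lam) • yClass x (n + 1) r +
        ∑ h : Fin k, (algebraMap ℂ (HolGerm x)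
          (r - lam - ((n + 1 : ℕ) + μ - 1) * ((h : ℕ) + 1)) * coord x h) •
          yClass x (n + 1) (r + ((h : ℕ) + 1)) := fun r x => rfl
  refine le_antisymm (Submodule.span_le.2 ?_) (Submodule.span_le.2 ?_)
  · have key : ∀ (d r : ℕ), r + d = k * (n + 1) → n + 1 ≤ r →
        glob V (fun x => yClass x (n + 1) r) ∈
          Submodule.span (HolSec V) (Set.range fun i => glob V (adaptedSec μ lam n i)) := by
      intro d
      induction d using Nat.strong_induction_on with
      | _ d ih =>
        intro r hd hr
        by_cases hrn : r ≤ k * n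
        · refine glob_mem_of_affine (t := thetaStalk μ lam (n + 1) r) (haff r)
            (sub_ne_zero.2 (hlam r hrn).symm)
            (Submodule.subset_span ⟨Sum.inl ⟨r, Finset.mem_Icc.2 ⟨hr, hrn⟩⟩, rfl⟩) fun h => ?_
          have hh := h.2
          have hkn : k * (n + 1) = k * n + k := Nat.mul_succ k n
          exact ih (d - ((h : ℕ) + 1)) (by omega) (r + ((h : ℕ) + 1)) (by omega) (by omega)
        · rw [Nat.mul_succ] at hd
          refine Submodule.subset_span ⟨Sum.inr ⟨r - (k * n + 1), by omega⟩, ?_⟩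
          simp only [adaptedSec]
          rw [Nat.add_sub_cancel' (by omega)]
    rintro _ ⟨_, ⟨α, hα, rfl⟩, rfl⟩
    have h1 := len_le_wt α
    have h2 := wt_le_mul_len α
    have h3 : (fun x => (idealA x).mkQ (pdPow x α)) = fun x => yClass x (n + 1) (wt α) := by
      funext x
      rw [← hα, yClass_len_wt]
    rw [hα] at h1 h2
    rw [h3]
    exact key (k * (n + 1) - wt α) (wt α) (by omega) h1
  · rintro _ ⟨r | j, rfl⟩
    · change glob V (thetaStalk μ lam (n + 1) r) ∈ _
      rw [glob_affine V (haff r)]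
      exact Submodule.add_mem _ (Submodule.smul_mem _ _ (glob_yClass_mem _ V _))
        (Submodule.sum_mem _ fun h _ => Submodule.smul_mem _ _ (glob_yClass_mem _ V _))
    · exact glob_yClass_mem _ V _

/-- The quotient map kills the θ part, so the coefficients of the y's vanish first. -/
theorem adaptedSec_linearIndependent (hk : 0 < k) {n : ℕ} (hlam : ∀ i : ℕ, i ≤ k * n → lam ≠ i)
    (x : Pt k) : LinearIndependent (HolGerm x) fun i => adaptedSec μ lam n i x := by
  rw [Fintype.linearIndependent_iff]
  intro g hg
  rw [Fintype.sum_sum_type] at hg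
  have hr : ∀ j, g (Sum.inr j) = 0 := by
    have h1 := congrArg (quotStalk μ lam x) hg
    rw [map_add, map_sum, map_sum, map_zero, Finset.sum_eq_zero, zero_add] at h1
    · refine Fintype.linearIndependent_iff.1 (quotStalk_top_linearIndependent μ lam hk hlam x)
        (fun j => g (Sum.inr j)) ?_
      rw [← h1]
      exact Finset.sum_congr rfl fun j _ => (quotStalk_smul μ lam x _ _).symm
    · intro r _
      rw [quotStalk_smul, adaptedSec, quotStalk_thetaStalk μ lam hk x (Finset.mem_Icc.1 r.2).1
        (Finset.mem_Icc.1 r.2).2, smul_zero]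
  have hl : ∀ r, g (Sum.inl r) = 0 := by
    refine Fintype.linearIndependent_iff.1 (theta_linearIndependent μ lam hlam x)
      (fun r => g (Sum.inl r)) ?_
    rw [← hg]
    simp only [hr, zero_smul, Finset.sum_const_zero, add_zero]
    rfl
  rintro (r | j)
  exacts [hl r, hr j]

/-! ### Generators of `N_{μ,λ}(q)` -/

/-- Elimination in two stages: for p ≤ n the U-relation of t^r solves for y_{p,r} in degree p+1, and
in degree n+1 the vanishing of θ_{n+1,r} moves r upwards past kn. Here d and e measure what is left
in each stage. -/
theorem glob_quotStalk_mem (hk : 0 < k) {n : ℕ} (hlam : ∀ i : ℕ, i ≤ k * n → lam ≠ i)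
    (V : Opens (Pt k)) (d p : ℕ) (hp : p + d = n + 1) (e r : ℕ) (hr : r + e = k * p) (hpr : p ≤ r) :
    glob V (fun x => quotStalk μ lam x (yClass x p r)) ∈
      Submodule.span (HolSec V) (Set.range fun j : Fin k =>
        glob V fun x => quotStalk μ lam x (yClass x (n + 1) (k * n + 1 + (j : ℕ)))) := by
  have hzero : glob V (fun x => (0 : NStalk μ lam x)) ∈
      Submodule.span (HolSec V) (Set.range fun j : Fin k =>
        glob V fun x => quotStalk μ lam x (yClass x (n + 1) (k * n + 1 + (j : ℕ)))) :=
    Submodule.zero_mem _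
  induction d generalizing p e r with
  | zero =>
    obtain rfl : p = n + 1 := hp
    induction e using Nat.strong_induction_on generalizing r with
    | _ e ih =>
      by_cases hrn : r ≤ k * n
      · refine glob_mem_of_affine (t := fun x => 0) (c := r - lam)
          (b := fun h x => quotStalk μ lam x (yClass x (n + 1) (r + ((h : ℕ) + 1))))
          (d := fun h => r - lam - ((n + 1 : ℕ) + μ - 1) * ((h : ℕ) + 1)) (fun x => ?_)
          (sub_ne_zero.2 (hlam r hrn).symm) hzero fun h => ?_
        · rw [← quotStalk_thetaStalk μ lam hk x hpr hrn, thetaStalk, map_add, map_sum,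
            quotStalk_smul]
          simp only [quotStalk_smul]
        · have hh := h.2
          have hkn : k * (n + 1) = k * n + k := Nat.mul_succ k n
          exact ih (e - ((h : ℕ) + 1)) (by omega) (r + ((h : ℕ) + 1)) (by omega) (by omega)
      · rw [Nat.mul_succ] at hr
        refine Submodule.subset_span ⟨⟨r - (k * n + 1), by omega⟩, ?_⟩
        simp only
        rw [Nat.add_sub_cancel' (by omega)]
  | succ d ih =>
    have hrn : r ≤ k * n := le_trans (by omega) (Nat.mul_le_mul_left k (by omega : p ≤ n))
    refine glob_mem_of_affine (t := fun x => 0) (c := r - lam)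
      (b := fun h x => quotStalk μ lam x (yClass x (p + 1) (r + ((h : ℕ) + 1))))
      (d := fun h => (h : ℕ) + 1) (fun x => ?_)
      (sub_ne_zero.2 (hlam r hrn).symm) hzero fun h => ?_
    · have h1 : quotStalk μ lam x (relU x lam p (monomial r 1)) = 0 := by
        rw [quotStalk_eq_zero_iff x μ lam hk]
        exact Submodule.subset_span (Or.inr ⟨p, r, hpr, by omega, rfl⟩)
      rw [← h1, relU_monomial, map_add, map_sum, quotStalk_smul, add_comm]
      simp only [quotStalk_smul, map_add, map_natCast, map_one]
    · have hh := h.2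
      have hkn : k * (p + 1) = k * p + k := Nat.mul_succ k p
      exact ih (p + 1) (by omega) (k * (p + 1) - (r + ((h : ℕ) + 1))) (r + ((h : ℕ) + 1)) (by omega)
        (by omega)

theorem combSec_genN (hk : 0 < k) {n : ℕ} (hlam : ∀ i : ℕ, i ≤ k * n → lam ≠ i)
    (V : Opens (Pt k)) : combSec (genN k μ lam (n + 1)) V =
      Submodule.span (HolSec V) (Set.range fun j : Fin k =>
        glob V fun x => quotStalk μ lam x (yClass x (n + 1) (k * n + 1 + (j : ℕ)))) := by
  refine le_antisymm (Submodule.span_le.2 ?_) (Submodule.span_le.2 ?_)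
  · rintro _ ⟨_, ⟨α, hα, rfl⟩, rfl⟩
    have h3 : (fun x => (idealJ x μ lam).mkQ (pdPow x α)) =
        fun x => quotStalk μ lam x (yClass x (len α) (wt α)) := by
      funext x
      rw [yClass_len_wt, quotStalk_mkQ]
    have h2 := wt_le_mul_len α
    rw [h3]
    exact glob_quotStalk_mem μ lam hk hlam V (n + 1 - len α) (len α) (by omega)
      (k * len α - wt α) (wt α) (by omega) (len_le_wt α)
  · rintro _ ⟨j, rfl⟩
    have hj := top_index_le hk n j
    obtain ⟨α, h1, h2⟩ := exists_len_wt _ _ hj.1 hj.2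
    refine Submodule.subset_span ⟨_, ⟨α, h1.le, ?_⟩, rfl⟩
    funext x
    rw [← h1, ← h2, yClass_len_wt, quotStalk_mkQ]

/-! ### Local surjectivity, the kernel of L_q and freeness of N(q) -/

theorem combSec_genN_le_map (hk : 0 < k) {n : ℕ} (hlam : ∀ i : ℕ, i ≤ k * n → lam ≠ i)
    (V : Opens (Pt k)) : combSec (genN k μ lam (n + 1)) V ≤
      (combSec (genW k (n + 1)) V).map (quotSec μ lam V) := by
  rw [combSec_genN μ lam hk hlam]
  refine Submodule.span_le.2 ?_
  rintro _ ⟨j, rfl⟩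
  exact ⟨_, glob_yClass_mem (n + 1) V (k * n + 1 + (j : ℕ)), rfl⟩

theorem mapL_locally_surjective (hk : 0 < k) {n : ℕ} (hlam : ∀ i : ℕ, i ≤ k * n → lam ≠ i)
    (U : Opens (Pt k)) (s : NSheaf k μ lam (n + 1) U) (x : Pt k) (hx : x ∈ U) :
    ∃ (V : Opens (Pt k)) (h : V ≤ U) (t : WSheaf k (n + 1) V), x ∈ V ∧
      (mapL k μ lam (n + 1) V t).1 = res h s.1 := by
  obtain ⟨V, hV, hxV, hs⟩ := s.2 ⟨x, hx⟩
  obtain ⟨t, ht, hts⟩ := combSec_genN_le_map μ lam hk hlam V hs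
  exact ⟨V, hV, ⟨t, combSec_le_genSheaf _ V ht⟩, hxV, hts⟩

theorem exists_basis_ker_mapL (hk : 0 < k) {n : ℕ} (hlam : ∀ i : ℕ, i ≤ k * n → lam ≠ i)
    (U : Opens (Pt k)) :
    ∃ b : Module.Basis (Finset.Icc (n + 1) (k * n)) (HolSec U)
        (LinearMap.ker (mapL k μ lam (n + 1) U)),
      ∀ r, (b r).1.1 = glob U (thetaStalk μ lam (n + 1) r) := by
  obtain ⟨B, hB⟩ : ∃ B : Module.Basis (Finset.Icc (n + 1) (k * n) ⊕ Fin k) (HolSec U)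
      (WSheaf k (n + 1) U), ∀ i, (B i : Fam WStalk U) = glob U (adaptedSec μ lam n i) :=
    exists_basis_genSheaf (genW k (n + 1)) (adaptedSec μ lam n)
    (combSec_genW μ lam hlam) (adaptedSec_linearIndependent μ lam hk hlam) U
  have hker : ∀ r, mapL k μ lam (n + 1) U (B (Sum.inl r)) = 0 := by
    intro r
    refine Subtype.ext (funext fun x => ?_)
    change quotStalk μ lam (x : Pt k) ((B (Sum.inl r) : Fam WStalk U) x) = 0
    rw [hB]
    exact quotStalk_thetaStalk μ lam hk (x : Pt k) (Finset.mem_Icc.1 r.2).1 (Finset.mem_Icc.1 r.2).2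
  have hLI : LinearIndependent (HolSec U) fun j => mapL k μ lam (n + 1) U (B (Sum.inr j)) := by
    refine LinearIndependent.of_comp (NSheaf k μ lam (n + 1) U).subtype ?_
    refine fam_linearIndependent (g := fun (j : Fin k) x =>
      quotStalk μ lam x (yClass x (n + 1) (k * n + 1 + (j : ℕ)))) U
      (quotStalk_top_linearIndependent μ lam hk hlam) fun j => ?_
    change quotSec μ lam U (B (Sum.inr j) : Fam WStalk U) = _
    rw [hB]
    rfl
  obtain ⟨b, hb⟩ := exists_basis_ker B _ hker hLI
  exact ⟨b, fun r => by rw [hb, hB]; rfl⟩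

theorem isFreeOfRank_genN (hk : 0 < k) {n : ℕ} (hlam : ∀ i : ℕ, i ≤ k * n → lam ≠ i) :
    IsFreeOfRank (genN k μ lam (n + 1)) k := by
  refine ⟨fun j => ⟨glob ⊤ fun x => quotStalk μ lam x (yClass x (n + 1) (k * n + 1 + (j : ℕ))),
    combSec_le_genSheaf _ _ ?_⟩, fun U => ?_⟩
  · rw [combSec_genN μ lam hk hlam]
    exact Submodule.subset_span ⟨j, rfl⟩
  · exact exists_basis_genSheaf (genN k μ lam (n + 1)) _ (combSec_genN μ lam hk hlam)
      (quotStalk_top_linearIndependent μ lam hk hlam) U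

end Main

end MuTrace

end

theorem proposition3p2p4 (k : ℕ) (hk : 1 ≤ k) (μ lam : ℂ) (q : ℕ) (hq : 1 ≤ q)
    (hlam : ∀ n : ℕ, n ≤ k * (q - 1) → lam ≠ n) :
    (∀ (U : TopologicalSpace.Opens (MuTrace.Pt k)) (s : MuTrace.NSheaf k μ lam q U),
      ∀ x ∈ U, ∃ (V : TopologicalSpace.Opens (MuTrace.Pt k)) (h : V ≤ U)
        (t : MuTrace.WSheaf k q V), x ∈ V ∧
          (MuTrace.mapL k μ lam q V t).1 = MuTrace.res h s.1) ∧
    (∀ U : TopologicalSpace.Opens (MuTrace.Pt k),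
      ∃ b : Module.Basis (Finset.Icc q (k * (q - 1))) (MuTrace.HolSec U)
          (LinearMap.ker (MuTrace.mapL k μ lam q U)),
        ∀ r, (b r).1.1 = MuTrace.glob U (MuTrace.thetaStalk μ lam q r)) ∧
    MuTrace.IsFreeOfRank (MuTrace.genN k μ lam q) k := by
  obtain ⟨n, rfl⟩ : ∃ n, q = n + 1 := ⟨q - 1, by omega⟩
  simp only [Nat.add_sub_cancel] at hlam ⊢
  exact ⟨MuTrace.mapL_locally_surjective μ lam hk hlam,
    MuTrace.exists_basis_ker_mapL μ lam hk hlam, MuTrace.isFreeOfRank_genN μ lam hk hlam⟩
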